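/- Let $K$ be an infinite field, $S=K[x_1,\dots,x_n]$ with its standard grading, and let $I\subseteq S$ be a nonzero ideal generated by forms of one degree $d$. For a finitely generated graded $S$-module $M$ let $\beta^S_{i,j}(M)$ be its graded Betti numbers (the number of generators of degree $j$ in homological position $i$ of the minimal graded free resolution of $M$) and $\operatorname{reg}(M)=\sup\{j-i:\beta^S_{i,j}(M)\neq 0\}$ its Castelnuovo–Mumford regularity. One says that $I$ has \emph{linear powers} if all generators of $I$ have the same degree, say $d$, and $\operatorname{reg}(I^k)=kd$ for every $k\in\mathbf N$. Let $m$ be the minimal number of generators of $I$, let $f_1,\dots,f_m$ be forms of degree $d$ that generate $I$, and let $A=K[x_1,\dots,x_n,y_1,\dots,y_m]$ be bigraded by $\deg x_i=(1,0)$, $\deg y_j=(0,1)$. The Rees algebra $\operatorname{Rees}(I)=\bigoplus_{j\ge 0} I^jt^j\subseteq S[t]$ is a bigraded $A$-module via $x_i\mapsto x_i$, $y_j\mapsto f_jt$, with components $\operatorname{Rees}(I)_{(i,j)}=(I^j)_{jd+i}\,t^j$ (and $0$ for $j<0$). For a finitely generated bigraded $A$-module $M$ with bigraded Betti numbers $\beta^A_{i,(a,b)}(M)$,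 put $$\operatorname{reg}_{(1,0)}(M)=\sup\{a-i:\beta^A_{i,(a,b)}(M)\neq 0\text{ for some }b\}.$$ Then $I$ has linear powers if and only if $\operatorname{reg}_{(1,0)}\operatorname{Rees}(I)=0$. -/

import Mathlib

open MvPolynomial

noncomputable section

universe u v w

section Betti

/-- A minimal graded free resolution
`⋯ → F₂ → F₁ → F₀ → M → 0` over the polynomial ring `R = K[X_s : s ∈ σ]`, graded by
`deg X_s = wt s`, of an `R`-module `M` with graded components `ℳ g`.  The module `F_i` is free of
finite rank with basis vectors `Pi.single e 1` of degree `deg i e`, that is, `F_i = ⨁ₑ R(-deg i e)`.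
The maps are homogeneous of degree `0`, and minimality says that the entries of the matrices of the
differentials lie in the ideal generated by the variables. -/
structure MinimalGradedFreeResolution (K : Type u) [Field K] {σ : Type v} {G : Type}
    [AddCommGroup G] {M : Type w} [AddCommGroup M] [Module (MvPolynomial σ K) M]
    (wt : σ → G) (ℳ : G → AddSubgroup M) where
  /-- the rank of `F_i` -/
  rank : ℕ → ℕ
  /-- the degrees of the basis vectors of `F_i` -/
  deg : ∀ i, Fin (rank i) → G
  /-- the differential `F_{i+1} → F_i` -/
  d : ∀ i, (Fin (rank (i + 1)) → MvPolynomial σ K) →ₗ[MvPolynomial σ K]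
    (Fin (rank i) → MvPolynomial σ K)
  /-- the augmentation `F_0 → M` -/
  ε : (Fin (rank 0) → MvPolynomial σ K) →ₗ[MvPolynomial σ K] M
  ε_homogeneous : ∀ e, ε (Pi.single e 1) ∈ ℳ (deg 0 e)
  d_homogeneous : ∀ i e e',
    IsWeightedHomogeneous wt (d i (Pi.single e 1) e') (deg (i + 1) e - deg i e')
  ε_surjective : Function.Surjective ε
  exact_zero : Function.Exact (d 0) ε
  exact_succ : ∀ i, Function.Exact (d (i + 1)) (d i)
  minimal : ∀ i e e',
    d i (Pi.single e 1) e' ∈ Ideal.span (Set.range (X : σ → MvPolynomial σ K))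

open Classical in
/-- The graded Betti number `β_{i,g}(M)`: the number of basis vectors of degree `g` in homological
position `i` of the (unique up to isomorphism) minimal graded free resolution of the finitely
generated graded module `M`. -/
def bettiNumber (K : Type u) [Field K] {σ : Type v} {G : Type} [AddCommGroup G]
    {M : Type w} [AddCommGroup M] [Module (MvPolynomial σ K) M]
    (wt : σ → G) (ℳ : G → AddSubgroup M) (i : ℕ) (g : G) : ℕ :=
  if h : Nonempty (MinimalGradedFreeResolution K wt ℳ) then
    Nat.card {e : Fin (h.some.rank i) // h.some.deg i e = g}
  else 0

end Betti

section Regularity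

/-- The standard grading `deg x_i = 1` of `K[x_1, …, x_n]`, with values in `ℤ`. -/
def stdWeight (n : ℕ) : Fin n → ℤ := fun _ => 1

/-- The bigrading `deg x_i = (1,0)`, `deg y_j = (0,1)` of `K[x_1, …, x_n, y_1, …, y_m]`. -/
def biWeight (n m : ℕ) : Fin n ⊕ Fin m → ℤ × ℤ :=
  Sum.elim (fun _ => (1, 0)) (fun _ => (0, 1))

/-- The Castelnuovo–Mumford regularity `sup {j - i : β_{i,j}(M) ≠ 0}` of a graded module over
`K[x_1, …, x_n]`; it is `-∞` for `M = 0`. -/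
def castelnuovoMumfordReg (K : Type u) [Field K] (n : ℕ) {M : Type w} [AddCommGroup M]
    [Module (MvPolynomial (Fin n) K) M]
    (ℳ : ℤ → AddSubgroup M) : EReal :=
  sSup {r : EReal | ∃ (i : ℕ) (j : ℤ),
    bettiNumber K (stdWeight n) ℳ i j ≠ 0 ∧ r = (((j - i : ℤ) : ℝ) : EReal)}

/-- The `(1,0)`-regularity `sup {a - i : β_{i,(a,b)}(M) ≠ 0 for some b}` of a bigraded module over
`K[x_1, …, x_n, y_1, …, y_m]`. -/
def reg10 (K : Type u) [Field K] (n m : ℕ) {M : Type w} [AddCommGroup M]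
    [Module (MvPolynomial (Fin n ⊕ Fin m) K) M]
    (ℳ : ℤ × ℤ → AddSubgroup M) : EReal :=
  sSup {r : EReal | ∃ (i : ℕ) (a : ℤ),
    (∃ b : ℤ, bettiNumber K (biWeight n m) ℳ i (a, b) ≠ 0) ∧ r = (((a - i : ℤ) : ℝ) : EReal)}

end Regularity

section LinearPowers

variable {K : Type u} [Field K] {n : ℕ}

/-- The grading on an ideal `J` of `K[x_1, …, x_n]`: `J_j` consists of the forms of degree `j`
in `J`. -/
def idealGrading (J : Ideal (MvPolynomial (Fin n) K)) (j : ℤ) : AddSubgroup J :=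
  (weightedHomogeneousSubmodule K (stdWeight n) j).toAddSubgroup.comap
    J.subtype.toAddMonoidHom

/-- `I` is generated by forms of degree `d`. -/
def IsGeneratedInDegree (I : Ideal (MvPolynomial (Fin n) K)) (d : ℕ) : Prop :=
  I = Ideal.span {f | f ∈ I ∧ f.IsHomogeneous d}

/-- `I` has linear powers: it is generated by forms of one degree `d`, and
`reg (I ^ k) = k * d` for every `k`. -/
def HasLinearPowers (I : Ideal (MvPolynomial (Fin n) K)) : Prop :=
  ∃ d : ℕ, IsGeneratedInDegree I d ∧
    ∀ k : ℕ, castelnuovoMumfordReg K n (idealGrading (I ^ k)) = (((k * d : ℕ) : ℝ) : EReal)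

end LinearPowers

section Rees

variable {K : Type u} [Field K] {n m : ℕ}

/-- The map `K[x_1, …, x_n, y_1, …, y_m] → Rees(I) ⊆ K[x_1, …, x_n][t]` with `x_i ↦ x_i` and
`y_j ↦ f_j t`. -/
def reesPresentation (I : Ideal (MvPolynomial (Fin n) K)) (f : Fin m → I) :
    MvPolynomial (Fin n ⊕ Fin m) K →ₐ[K] reesAlgebra I :=
  aeval (Sum.elim
    (fun i => algebraMap (MvPolynomial (Fin n) K) (reesAlgebra I) (X i))
    (fun j => ⟨Polynomial.monomial 1 (f j : MvPolynomial (Fin n) K),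
      reesAlgebra.monomial_mem.2 (by simp)⟩))

/-- The Rees algebra of `I`, regarded as a module over `K[x_1, …, x_n, y_1, …, y_m]` by means of
the elements `f_1, …, f_m` of `I`. -/
@[nolint unusedArguments]
def ReesModule (I : Ideal (MvPolynomial (Fin n) K)) (_f : Fin m → I) : Type u :=
  reesAlgebra I

instance (I : Ideal (MvPolynomial (Fin n) K)) (f : Fin m → I) : AddCommGroup (ReesModule I f) :=
  inferInstanceAs (AddCommGroup (reesAlgebra I))

instance (I : Ideal (MvPolynomial (Fin n) K)) (f : Fin m → I) :
    Module (MvPolynomial (Fin n ⊕ Fin m) K) (ReesModule I f) :=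
  Module.compHom (reesAlgebra I) (reesPresentation I f).toRingHom

/-- The coefficient of `t ^ j`, as an additive map `Rees(I) → K[x_1, …, x_n]`. -/
def reesCoeff (I : Ideal (MvPolynomial (Fin n) K)) (f : Fin m → I) (j : ℕ) :
    ReesModule I f →+ MvPolynomial (Fin n) K :=
  (Polynomial.lcoeff (MvPolynomial (Fin n) K) j).toAddMonoidHom.comp
    (reesAlgebra I).val.toRingHom.toAddMonoidHom

/-- The bigrading `Rees(I)_{(a,b)} = (I ^ b)_{b d + a} t ^ b` (zero for `b < 0`): the elements of
the Rees algebra whose coefficient of `t ^ b` is a form of degree `b d + a` and whose other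
coefficients vanish. -/
def reesGrading (I : Ideal (MvPolynomial (Fin n) K)) (f : Fin m → I) (d : ℕ) (g : ℤ × ℤ) :
    AddSubgroup (ReesModule I f) :=
  ⨅ j : ℕ, AddSubgroup.comap (reesCoeff I f j)
    (if (j : ℤ) = g.2 then
      (weightedHomogeneousSubmodule K (stdWeight n) (j * d + g.1)).toAddSubgroup
    else ⊥)

end Rees

end

/-! Write S = K[x]. The component of the Rees algebra in second degree k is the graded S-module I^k,
shifted by kd. Taking second degree k is exact, so it turns a bigraded free resolution F of Rees(I)
over A into a graded free resolution of I^k(kd) over S. Its generators are the products of a basis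
vector of F with a monomial in y, and multiplication by such a monomial does not change the first
degree. This strand need not be minimal. Both directions compare it with the minimal resolution L of
I^k through chain maps and a homotopy, reduced modulo x (`FreeStrand.exists_sub_mem_varMul`).

If the first degrees in F_i never exceed i, the strand has no generators of degree above i in
position i. Hence L has none of degree above i + kd (`deg_pow_le`).

Conversely, suppose that the powers satisfy this bound and that F_i has a basis vector e of bidegree
(a, k) with a > i. For the fixed number a, choose the position i minimal. Then F_{i-1} has no basis
vector of first degree a, so d(e) vanishes modulo x and e is a cycle modulo x in the strand. Since L
has no generator of degree a + kd in position i, e is a boundary modulo x. This contradicts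
minimality of F, because boundaries have no constant terms (`deg_rees_ne`, `deg_rees_le`).

The opposite inequalities for the regularities come from position 0: a nonzero form in I^k has
degree at least kd. So each regularity condition amounts to an upper bound on the degrees in a
resolution. The comparison works for arbitrary minimal resolutions, so it applies to the ones chosen
in `bettiNumber`, and uniqueness of minimal resolutions is not needed. -/

noncomputable section

universe u v w

/-! ### Graded modules and existence of minimal graded free resolutions -/

section GradedModules

variable {K : Type u} [Field K] {σ : Type v} {G : Type} [AddCommGroup G]
  {M : Type w} [AddCommGroup M] [Module (MvPolynomial σ K) M]

/-- The subgroups `ℳ g` of `M` are compatible with the grading of the polynomial ring and their sum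
is direct. -/
structure IsGradedModule (wt : σ → G) (ℳ : G → AddSubgroup M) : Prop where
  smul_mem : ∀ {p : MvPolynomial σ K} {g h : G} {z : M},
    IsWeightedHomogeneous wt p g → z ∈ ℳ h → p • z ∈ ℳ (g + h)
  eq_zero_of_sum_eq_zero : ∀ (s : Finset G) (z : G → M), (∀ g ∈ s, z g ∈ ℳ g) →
    ∑ g ∈ s, z g = 0 → ∀ g ∈ s, z g = 0

/-- Directness of a sum can be checked by means of additive maps that separate the summands. -/
theorem eq_zero_of_sum_eq_zero_of_projections {G : Type} {M : Type w} [AddCommGroup M]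
    {Q : Type*} [AddCommGroup Q] (ℳ : G → AddSubgroup M) (ι : M →+ Q)
    (hι : Function.Injective ι) (π : G → M →+ Q)
    (hsame : ∀ g, ∀ z ∈ ℳ g, π g z = ι z) (hne : ∀ g h, h ≠ g → ∀ z ∈ ℳ h, π g z = 0)
    (s : Finset G) (z : G → M) (hz : ∀ g ∈ s, z g ∈ ℳ g) (h0 : ∑ g ∈ s, z g = 0) :
    ∀ g ∈ s, z g = 0 := by
  intro g hg
  apply hι
  rw [map_zero, ← hsame g _ (hz g hg)]
  have := congrArg (π g) h0
  rw [map_sum, map_zero, Finset.sum_eq_single_of_mem g hg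
    (fun h hh hne' => hne g h hne' _ (hz h hh))] at this
  exact this

/-- The grading of the free module with basis vectors of degrees `deg e`. -/
def freeGrading (K : Type u) [Field K] (wt : σ → G) {r : ℕ} (deg : Fin r → G) (g : G) :
    AddSubgroup (Fin r → MvPolynomial σ K) where
  carrier := {z | ∀ e, IsWeightedHomogeneous wt (z e) (g - deg e)}
  add_mem' ha hb e := (ha e).add (hb e)
  zero_mem' _ := isWeightedHomogeneous_zero _ _ _
  neg_mem' ha e := (ha e).neg

theorem mem_freeGrading {wt : σ → G} {r : ℕ} {deg : Fin r → G} {g : G}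
    {z : Fin r → MvPolynomial σ K} :
    z ∈ freeGrading K wt deg g ↔ ∀ e, IsWeightedHomogeneous wt (z e) (g - deg e) := Iff.rfl

/-- The homogeneous component of degree `g` of an element of a graded free module. -/
def freeComponent (wt : σ → G) {r : ℕ} (deg : Fin r → G) (g : G) :
    (Fin r → MvPolynomial σ K) →+ (Fin r → MvPolynomial σ K) where
  toFun z e := weightedHomogeneousComponent wt (g - deg e) (z e)
  map_zero' := by ext; simp
  map_add' _ _ := by ext; simp

theorem freeComponent_apply (wt : σ → G) {r : ℕ} (deg : Fin r → G) (g : G)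
    (z : Fin r → MvPolynomial σ K) (e : Fin r) :
    freeComponent wt deg g z e = weightedHomogeneousComponent wt (g - deg e) (z e) := rfl

theorem freeComponent_mem (wt : σ → G) {r : ℕ} (deg : Fin r → G) (g : G)
    (z : Fin r → MvPolynomial σ K) : freeComponent wt deg g z ∈ freeGrading K wt deg g :=
  fun _ => weightedHomogeneousComponent_isWeightedHomogeneous _ _

theorem freeComponent_of_mem {wt : σ → G} {r : ℕ} {deg : Fin r → G} {g : G}
    {z : Fin r → MvPolynomial σ K} (hz : z ∈ freeGrading K wt deg g) :
    freeComponent wt deg g z = z := by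
  ext1 e
  exact (hz e).weightedHomogeneousComponent_same

theorem freeComponent_of_mem_ne {wt : σ → G} {r : ℕ} {deg : Fin r → G} {g h : G} (hne : h ≠ g)
    {z : Fin r → MvPolynomial σ K} (hz : z ∈ freeGrading K wt deg h) :
    freeComponent wt deg g z = 0 := by
  ext1 e
  refine (hz e).weightedHomogeneousComponent_ne _ ?_
  simpa using hne.symm

theorem exists_sum_freeComponent (wt : σ → G) {r : ℕ} (deg : Fin r → G)
    (z : Fin r → MvPolynomial σ K) :
    ∃ s : Finset G, ∀ t, s ⊆ t → ∑ g ∈ t, freeComponent wt deg g z = z := by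
  classical
  have hfin : ∀ e, (Function.support fun g => weightedHomogeneousComponent wt g (z e)).Finite :=
    fun e => weightedHomogeneousComponent_finsupp (z e)
  let s : Finset G := Finset.univ.biUnion fun e =>
    (hfin e).toFinset.image (· + deg e)
  refine ⟨s, fun t hst => ?_⟩
  ext1 e
  rw [Finset.sum_apply]
  simp only [freeComponent_apply]
  have hinj : Function.Injective (fun g : G => g - deg e) := sub_left_injective
  rw [← Finset.sum_image (f := fun g => weightedHomogeneousComponent wt g (z e))
    (g := fun g => g - deg e) (hinj.injOn)]
  conv_rhs => rw [← sum_weightedHomogeneousComponent wt (z e)]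
  rw [finsum_eq_sum_of_support_subset]
  intro g hg
  rw [Finset.mem_coe, Finset.mem_image]
  refine ⟨g + deg e, hst ?_, by simp⟩
  rw [Finset.mem_biUnion]
  refine ⟨e, Finset.mem_univ _, Finset.mem_image_of_mem _ ?_⟩
  rw [Set.Finite.mem_toFinset]
  exact hg

theorem isGradedModule_freeGrading (wt : σ → G) {r : ℕ} (deg : Fin r → G) :
    IsGradedModule (K := K) wt (freeGrading K wt deg) where
  smul_mem hp hz e := by
    rw [add_sub_assoc]
    exact hp.mul (hz e)
  eq_zero_of_sum_eq_zero :=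
    eq_zero_of_sum_eq_zero_of_projections _ (AddMonoidHom.id _) Function.injective_id
      (freeComponent wt deg) (fun _ _ hz => freeComponent_of_mem hz)
      (fun _ _ hne _ hz => freeComponent_of_mem_ne hne hz)

theorem single_mem_freeGrading (wt : σ → G) {r : ℕ} (deg : Fin r → G) (e : Fin r) :
    Pi.single e 1 ∈ freeGrading K wt deg (deg e) := by
  intro e'
  rcases eq_or_ne e' e with rfl | h
  · simpa using isWeightedHomogeneous_one K wt
  · rw [Pi.single_eq_of_ne h]
    exact isWeightedHomogeneous_zero _ _ _

theorem linearMap_apply_eq_sum {r : ℕ} (φ : (Fin r → MvPolynomial σ K) →ₗ[MvPolynomial σ K] M)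
    (z : Fin r → MvPolynomial σ K) : φ z = ∑ e, z e • φ (Pi.single e 1) := by
  conv_lhs => rw [pi_eq_sum_univ' z]
  rw [map_sum]
  refine Finset.sum_congr rfl fun e _ => ?_
  rw [map_smul]

namespace IsGradedModule

variable {wt : σ → G} {ℳ : G → AddSubgroup M}

theorem map_mem (hM : IsGradedModule (K := K) wt ℳ) {r : ℕ} {deg : Fin r → G}
    {φ : (Fin r → MvPolynomial σ K) →ₗ[MvPolynomial σ K] M}
    (hφ : ∀ e, φ (Pi.single e 1) ∈ ℳ (deg e)) {g : G} {z : Fin r → MvPolynomial σ K}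
    (hz : z ∈ freeGrading K wt deg g) : φ z ∈ ℳ g := by
  rw [linearMap_apply_eq_sum]
  refine sum_mem fun e _ => ?_
  have := hM.smul_mem (hz e) (hφ e)
  rwa [sub_add_cancel] at this

/-- A homogeneous map commutes with taking components. This is what makes kernels homogeneous and
lets homogeneous elements of an image have homogeneous preimages. -/
theorem map_freeComponent (hM : IsGradedModule (K := K) wt ℳ) {r : ℕ} {deg : Fin r → G}
    {φ : (Fin r → MvPolynomial σ K) →ₗ[MvPolynomial σ K] M}
    (hφ : ∀ e, φ (Pi.single e 1) ∈ ℳ (deg e)) {g : G} {z : Fin r → MvPolynomial σ K}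
    (hz : φ z ∈ ℳ g) : φ (freeComponent wt deg g z) = φ z := by
  classical
  obtain ⟨s, hs⟩ := exists_sum_freeComponent wt deg z
  have hg : g ∈ insert g s := Finset.mem_insert_self _ _
  have hsum := hs (insert g s) (Finset.subset_insert _ _)
  -- The images of the components add up to `φ z`, which is itself homogeneous of degree `g`.
  -- Subtracting it in degree `g` gives a family of sum zero, to which directness applies.
  have key := hM.eq_zero_of_sum_eq_zero (insert g s)
    (fun h => φ (freeComponent wt deg h z) - if h = g then φ z else 0) ?_ ?_ g hg
  · simpa [sub_eq_zero] using key
  · intro h _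
    refine sub_mem (hM.map_mem hφ (freeComponent_mem _ _ _ _)) ?_
    split_ifs with h'
    · exact h' ▸ hz
    · exact zero_mem _
  · rw [Finset.sum_sub_distrib, ← map_sum, hsum, Finset.sum_ite_eq' _ g, if_pos hg, sub_self]

end IsGradedModule

theorem mem_span_range_X_iff {p : MvPolynomial σ K} :
    p ∈ Ideal.span (Set.range (X : σ → MvPolynomial σ K)) ↔ constantCoeff p = 0 := by
  have := mem_pow_idealOfVars_iff (σ := σ) (R := K) 1 p
  rw [pow_one, idealOfVars] at this
  rw [this, constantCoeff_eq]
  constructor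
  · intro h
    by_contra h0
    have := h 0 (mem_support_iff.2 h0)
    simp at this
  · intro h c hc
    rw [Nat.one_le_iff_ne_zero, Ne, Finsupp.degree_eq_zero_iff]
    rintro rfl
    exact mem_support_iff.1 hc h

/-- Positivity of the grading leaves only the constant monomial in degree 0. Thus a degree-0
coefficient is a scalar, invertible as soon as it is nonzero. -/
theorem weightedHomogeneousComponent_zero_eq_C {wt : σ → G}
    (hpos : ∀ c : σ →₀ ℕ, Finsupp.weight wt c = 0 → c = 0) (p : MvPolynomial σ K) :
    weightedHomogeneousComponent wt 0 p = C (constantCoeff p) := by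
  classical
  ext c
  rw [coeff_weightedHomogeneousComponent, coeff_C, constantCoeff_eq]
  by_cases hc : c = 0
  · subst hc
    simp
  · rw [if_neg (fun h => hc (hpos c h)), if_neg (Ne.symm hc)]

/-- A finitely generated homogeneous submodule of a graded module is the image of a graded free
module of finite rank under a homogeneous map whose kernel has no entries with a constant term. -/
theorem exists_minimal_cover {wt : σ → G}
    (hpos : ∀ c : σ →₀ ℕ, Finsupp.weight wt c = 0 → c = 0) {ℳ : G → AddSubgroup M}
    (hM : IsGradedModule (K := K) wt ℳ) (N : Submodule (MvPolynomial σ K) M) (hfg : N.FG)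
    (hN : N ≤ Submodule.span _ {z | z ∈ N ∧ ∃ g, z ∈ ℳ g}) :
    ∃ (r : ℕ) (deg : Fin r → G) (φ : (Fin r → MvPolynomial σ K) →ₗ[MvPolynomial σ K] M),
      (∀ e, φ (Pi.single e 1) ∈ ℳ (deg e)) ∧ LinearMap.range φ = N ∧
      ∀ z, φ z = 0 → ∀ e, z e ∈ Ideal.span (Set.range (X : σ → MvPolynomial σ K)) := by
  classical
  have hex : ∃ (r : ℕ) (v : Fin r → M), (∀ e, ∃ g, v e ∈ ℳ g) ∧
      Submodule.span (MvPolynomial σ K) (Set.range v) = N := by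
    obtain ⟨t, ht⟩ := hfg
    obtain ⟨t', ht's, htt'⟩ := Submodule.subset_span_finite_of_subset_span
      (R := MvPolynomial σ K) (t := t)
      (s := {z | z ∈ N ∧ ∃ g, z ∈ ℳ g})
      ((Submodule.subset_span.trans ht.le).trans hN)
    refine ⟨t'.card, fun e => (t'.equivFin.symm e : M), fun e => (ht's (t'.equivFin.symm e).2).2, ?_⟩
    have hrange : Set.range (fun e => ((t'.equivFin.symm e : t') : M)) = (t' : Set M) := by
      rw [show (fun e => ((t'.equivFin.symm e : t') : M)) = Subtype.val ∘ t'.equivFin.symm from rfl,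
        t'.equivFin.symm.surjective.range_comp]
      simp
    rw [hrange]
    refine le_antisymm (Submodule.span_le.2 fun z hz => (ht's hz).1) ?_
    rw [← ht]
    exact Submodule.span_le.2 htt'
  -- A homogeneous generating family of least possible size: a relation with a nonzero constant term
  -- would allow one generator to be dropped.
  obtain ⟨v, hv, hspan⟩ := Nat.find_spec hex
  have hmin : ∀ r, r < Nat.find hex → _ := fun r hr => Nat.find_min hex hr
  generalize Nat.find hex = r at *
  choose deg hdeg using hv
  let φ := Fintype.linearCombination (MvPolynomial σ K) v
  have hφ1 : ∀ e, φ (Pi.single e 1) = v e := fun e => by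
    simp [φ, Fintype.linearCombination_apply_single]
  have hφ : ∀ e, φ (Pi.single e 1) ∈ ℳ (deg e) := fun e => by rw [hφ1]; exact hdeg e
  refine ⟨r, deg, φ, hφ, by rw [← hspan]; exact Fintype.range_linearCombination _ _, ?_⟩
  intro z hz e
  rw [mem_span_range_X_iff]
  by_contra hc
  obtain _ | r := r
  · exact e.elim0
  refine hmin r (Nat.lt_succ_self r) ⟨fun i => v (e.succAbove i), fun i => ⟨_, hdeg _⟩, ?_⟩
  -- In the component of degree `deg e` of the relation, the coefficient of `v e` has degree 0,
  -- hence is the nonzero constant term of `z e`. Dividing by it expresses `v e` through the other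
  -- generators.
  have hz' : φ (freeComponent wt deg (deg e) z) = 0 := by
    rw [hM.map_freeComponent hφ (by rw [hz]; exact zero_mem _), hz]
  have hve : v e ∈ Submodule.span (MvPolynomial σ K) (Set.range fun i => v (e.succAbove i)) := by
    rw [linearMap_apply_eq_sum, Fin.sum_univ_succAbove _ e, freeComponent_apply, sub_self,
      weightedHomogeneousComponent_zero_eq_C hpos] at hz'
    simp only [hφ1] at hz'
    have hmem : (C (constantCoeff (z e)) : MvPolynomial σ K) • v e ∈
        Submodule.span (MvPolynomial σ K) (Set.range fun i => v (e.succAbove i)) := by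
      rw [eq_neg_of_add_eq_zero_left hz']
      exact neg_mem (sum_mem fun i _ => Submodule.smul_mem _ _ (Submodule.subset_span ⟨i, rfl⟩))
    have := Submodule.smul_mem _ (C (constantCoeff (z e))⁻¹ : MvPolynomial σ K) hmem
    rwa [smul_smul, ← C_mul, inv_mul_cancel₀ hc, C_1, one_smul] at this
  rw [← hspan]
  refine le_antisymm (Submodule.span_mono ?_) (Submodule.span_le.2 ?_)
  · rintro _ ⟨i, rfl⟩
    exact ⟨_, rfl⟩
  · rintro _ ⟨i, rfl⟩
    rcases Fin.eq_self_or_eq_succAbove e i with rfl | ⟨j, rfl⟩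
    · exact hve
    · exact Submodule.subset_span ⟨j, rfl⟩

/-- A homogeneous submodule, without constant terms, of a graded free module of finite rank. -/
structure SyzygyModule (K : Type u) [Field K] (wt : σ → G) where
  /-- the rank of the free module -/
  rank : ℕ
  /-- the degrees of its basis vectors -/
  deg : Fin rank → G
  /-- the submodule -/
  carrier : Submodule (MvPolynomial σ K) (Fin rank → MvPolynomial σ K)
  freeComponent_mem : ∀ z ∈ carrier, ∀ g, freeComponent wt deg g z ∈ carrier
  mem_span_X : ∀ z ∈ carrier, ∀ e, z e ∈ Ideal.span (Set.range (X : σ → MvPolynomial σ K))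

/-- One step of the resolution. The new kernel is again a syzygy module without constant terms, so
the step can be iterated; Hilbert's basis theorem keeps the ranks finite. -/
theorem SyzygyModule.exists_cover [Finite σ] {wt : σ → G}
    (hpos : ∀ c : σ →₀ ℕ, Finsupp.weight wt c = 0 → c = 0) (N : SyzygyModule K wt) :
    ∃ (N' : SyzygyModule K wt) (d : (Fin N'.rank → MvPolynomial σ K) →ₗ[MvPolynomial σ K]
        (Fin N.rank → MvPolynomial σ K)),
      (∀ e, d (Pi.single e 1) ∈ freeGrading K wt N.deg (N'.deg e)) ∧
      LinearMap.range d = N.carrier ∧ LinearMap.ker d = N'.carrier := by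
  have hgr := isGradedModule_freeGrading (K := K) wt N.deg
  obtain ⟨r, deg, d, hd, hrange, hker⟩ := exists_minimal_cover hpos hgr N.carrier
    (IsNoetherian.noetherian _) (by
      intro z hz
      obtain ⟨s, hs⟩ := exists_sum_freeComponent wt N.deg z
      rw [← hs s subset_rfl]
      exact sum_mem fun g _ => Submodule.subset_span
        ⟨N.freeComponent_mem z hz g, g, _root_.freeComponent_mem _ _ _ _⟩)
  refine ⟨⟨r, deg, LinearMap.ker d, fun z hz g => ?_, fun z hz => hker z hz⟩, d, hd, hrange, rfl⟩
  rw [LinearMap.mem_ker] at hz ⊢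
  rw [hgr.map_freeComponent hd (by rw [hz]; exact zero_mem _), hz]

/-- Finitely generated graded modules over a positively graded polynomial ring have minimal graded
free resolutions. -/
theorem nonempty_minimalGradedFreeResolution [Finite σ] {wt : σ → G}
    (hpos : ∀ c : σ →₀ ℕ, Finsupp.weight wt c = 0 → c = 0) {ℳ : G → AddSubgroup M}
    (hM : IsGradedModule (K := K) wt ℳ) (hfg : Module.Finite (MvPolynomial σ K) M)
    (hgen : Submodule.span (MvPolynomial σ K) {z | ∃ g, z ∈ ℳ g} = ⊤) :
    Nonempty (MinimalGradedFreeResolution K wt ℳ) := by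
  obtain ⟨r, deg, ε, hε, hrange, hker⟩ := exists_minimal_cover hpos hM ⊤ hfg.fg_top
    (by simp [hgen])
  choose next d hd hdrange hdker using SyzygyModule.exists_cover (K := K) hpos
  let N₀ : SyzygyModule K wt := ⟨r, deg, LinearMap.ker ε, fun z hz g => by
    rw [LinearMap.mem_ker] at hz ⊢
    rw [hM.map_freeComponent hε (by rw [hz]; exact zero_mem _), hz], fun z hz => hker z hz⟩
  let N : ℕ → SyzygyModule K wt := fun i => Nat.rec N₀ (fun _ => next) i
  exact ⟨{
    rank := fun i => (N i).rank
    deg := fun i => (N i).deg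
    d := fun i => d (N i)
    ε := ε
    ε_homogeneous := hε
    d_homogeneous := fun i e e' => hd (N i) e e'
    ε_surjective := LinearMap.range_eq_top.1 hrange
    exact_zero := LinearMap.exact_iff.2 (hdrange N₀).symm
    exact_succ := fun i => LinearMap.exact_iff.2 ((hdker (N i)).trans (hdrange (N (i + 1))).symm)
    minimal := fun i e e' => (N i).mem_span_X _
      ((hdrange (N i)).le (LinearMap.mem_range_self _ _)) e' }⟩

end GradedModules

/-! ### Chain maps and homotopies between graded free strands -/

section Comparison

variable {K : Type u} [Field K] {n : ℕ}

/-- The part of `P` described by the subgroups `𝒢 a` is freely generated by homogeneous members of a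
basis of `P`. -/
def IsGradedFree (K : Type u) [Field K] (n : ℕ) {P : Type*} [AddCommGroup P]
    [Module (MvPolynomial (Fin n) K) P] (𝒢 : ℤ → AddSubgroup P) : Prop :=
  ∃ (ι : Type) (b : Module.Basis ι (MvPolynomial (Fin n) K) P) (deg : ι → ℤ) (J : Set ι),
    (∀ j ∈ J, b j ∈ 𝒢 (deg j)) ∧
    ∀ a, 𝒢 a ≤ AddSubgroup.closure {z | ∃ j ∈ J, ∃ s : MvPolynomial (Fin n) K,
      IsWeightedHomogeneous (stdWeight n) s (a - deg j) ∧ z = s • b j}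

/-- Homogeneous maps from a graded free module lift along a map that is surjective onto their
image. -/
theorem IsGradedFree.exists_lift {P Q Q' : Type*} [AddCommGroup P] [AddCommGroup Q]
    [AddCommGroup Q'] [Module (MvPolynomial (Fin n) K) P] [Module (MvPolynomial (Fin n) K) Q]
    [Module (MvPolynomial (Fin n) K) Q'] {𝒢 : ℤ → AddSubgroup P} (hP : IsGradedFree K n 𝒢)
    {ℋ : ℤ → AddSubgroup Q'}
    (hℋ : ∀ (s : MvPolynomial (Fin n) K) (w a : ℤ) (z : Q'),
      IsWeightedHomogeneous (stdWeight n) s w → z ∈ ℋ a → s • z ∈ ℋ (w + a))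
    (q : Q' →ₗ[MvPolynomial (Fin n) K] Q) (u : P →ₗ[MvPolynomial (Fin n) K] Q)
    (hu : ∀ a, ∀ z ∈ 𝒢 a, ∃ y ∈ ℋ a, q y = u z) :
    ∃ v : P →ₗ[MvPolynomial (Fin n) K] Q', (∀ a, ∀ z ∈ 𝒢 a, v z ∈ ℋ a) ∧
      ∀ a, ∀ z ∈ 𝒢 a, q (v z) = u z := by
  classical
  obtain ⟨ι, b, deg, J, hb, hcl⟩ := hP
  choose y hy hqy using fun j : J => hu (deg j) (b j) (hb j j.2)
  -- The lift is defined on the whole module, with the value 0 on basis elements outside `J`. This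
  -- is harmless because only its restriction to the span of the graded parts is controlled.
  let v := b.constr ℕ fun j => if h : j ∈ J then y ⟨j, h⟩ else 0
  have hv : ∀ j (hj : j ∈ J), v (b j) = y ⟨j, hj⟩ := fun j hj => by
    simp [v, Module.Basis.constr_basis, hj]
  refine ⟨v, fun a z hz => ?_, fun a z hz => ?_⟩
  · refine AddSubgroup.closure_induction (p := fun z _ => v z ∈ ℋ a) ?_ ?_ ?_ ?_ (hcl a hz)
    · rintro _ ⟨j, hj, s, hs, rfl⟩
      rw [map_smul, hv j hj]
      have := hℋ s _ _ _ hs (hy ⟨j, hj⟩)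
      rwa [sub_add_cancel] at this
    · rw [map_zero]; exact zero_mem _
    · intro x y _ _ hx hy
      rw [map_add]; exact add_mem hx hy
    · intro x _ hx
      rw [map_neg]; exact neg_mem hx
  · refine AddSubgroup.closure_induction (p := fun z _ => q (v z) = u z) ?_ ?_ ?_ ?_ (hcl a hz)
    · rintro _ ⟨j, hj, s, hs, rfl⟩
      rw [map_smul, map_smul, map_smul, hv j hj, hqy ⟨j, hj⟩]
    · simp
    · intro x y _ _ hx hy
      rw [map_add, map_add, map_add, hx, hy]
    · intro x _ hx
      rw [map_neg, map_neg, map_neg, hx]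

/-- A strand of a graded free resolution: a complex of `K[x_1, …, x_n]`-modules that is, in the
degrees recorded by the subgroups `gr i a`, graded free, and exact when `cyc 0` is regarded as the
module of cycles in position `0`. -/
structure FreeStrand (K : Type u) [Field K] (n : ℕ) where
  /-- the modules -/
  obj : ℕ → Type u
  [acg : ∀ i, AddCommGroup (obj i)]
  [mod : ∀ i, Module (MvPolynomial (Fin n) K) (obj i)]
  /-- the graded components -/
  gr : ∀ i, ℤ → AddSubgroup (obj i)
  /-- the differentials -/
  d : ∀ i, obj (i + 1) →ₗ[MvPolynomial (Fin n) K] obj i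
  /-- the cycles -/
  cyc : ∀ i, Submodule (MvPolynomial (Fin n) K) (obj i)
  smul_mem : ∀ i (s : MvPolynomial (Fin n) K) (w a : ℤ) (z : obj i),
    IsWeightedHomogeneous (stdWeight n) s w → z ∈ gr i a → s • z ∈ gr i (w + a)
  d_mem : ∀ i a, ∀ z ∈ gr (i + 1) a, d i z ∈ gr i a
  d_cyc : ∀ i z, d i z ∈ cyc i
  mem_cyc_succ : ∀ i z, z ∈ cyc (i + 1) ↔ d i z = 0
  exact : ∀ i a, ∀ z ∈ gr i a, z ∈ cyc i → ∃ w ∈ gr (i + 1) a, d i w = z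
  free : ∀ i, IsGradedFree K n (gr i)

attribute [instance] FreeStrand.acg FreeStrand.mod

/-- Dependent recursion for existence statements. -/
theorem exists_sequence {T : ℕ → Type*} (P : ∀ i, T i → Prop) (R : ∀ i, T i → T (i + 1) → Prop)
    (t₀ : T 0) (h₀ : P 0 t₀) (step : ∀ i t, P i t → ∃ t', P (i + 1) t' ∧ R i t t') :
    ∃ t : ∀ i, T i, t 0 = t₀ ∧ (∀ i, P i (t i)) ∧ ∀ i, R i (t i) (t (i + 1)) := by
  choose f hf using step
  let s : ∀ i, {t : T i // P i t} := fun i =>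
    Nat.rec ⟨t₀, h₀⟩ (fun i t => ⟨f i t.1 t.2, (hf i t.1 t.2).1⟩) i
  exact ⟨fun i => (s i).1, rfl, fun i => (s i).2, fun i => (hf i _ (s i).2).2⟩

namespace FreeStrand

/-- Lifting position by position, with the invariant that each map preserves degrees and sends
homogeneous cycles to cycles. Exactness of `B` then provides the next lift. -/
theorem exists_chain_map (A B : FreeStrand K n)
    (φ₀ : A.obj 0 →ₗ[MvPolynomial (Fin n) K] B.obj 0)
    (hφ₀ : ∀ a, ∀ z ∈ A.gr 0 a, φ₀ z ∈ B.gr 0 a)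
    (hcyc : ∀ a, ∀ z ∈ A.gr 0 a, z ∈ A.cyc 0 → φ₀ z ∈ B.cyc 0) :
    ∃ φ : ∀ i, A.obj i →ₗ[MvPolynomial (Fin n) K] B.obj i, φ 0 = φ₀ ∧
      (∀ i a, ∀ z ∈ A.gr i a, φ i z ∈ B.gr i a) ∧
      ∀ i a, ∀ z ∈ A.gr (i + 1) a, B.d i (φ (i + 1) z) = φ i (A.d i z) := by
  refine Exists.elim (exists_sequence
    (T := fun i => A.obj i →ₗ[MvPolynomial (Fin n) K] B.obj i)
    (fun i φ => (∀ a, ∀ z ∈ A.gr i a, φ z ∈ B.gr i a) ∧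
      ∀ a, ∀ z ∈ A.gr i a, z ∈ A.cyc i → φ z ∈ B.cyc i)
    (fun i φ φ' => ∀ a, ∀ z ∈ A.gr (i + 1) a, B.d i (φ' z) = φ (A.d i z)) φ₀ ⟨hφ₀, hcyc⟩ ?_)
    fun φ ⟨h0, hP, hR⟩ => ⟨φ, h0, fun i => (hP i).1, hR⟩
  rintro i φ ⟨hφ, hφc⟩
  obtain ⟨v, hv, hvq⟩ := (A.free (i + 1)).exists_lift (B.smul_mem (i + 1)) (B.d i)
    (φ ∘ₗ A.d i) (fun a z hz => B.exact i a _ (hφ a _ (A.d_mem i a z hz))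
      (hφc a _ (A.d_mem i a z hz) (A.d_cyc i z)))
  refine ⟨v, ⟨hv, fun a z hz hc => ?_⟩, hvq⟩
  rw [B.mem_cyc_succ, hvq a z hz, LinearMap.comp_apply, (A.mem_cyc_succ i z).1 hc, map_zero]

/-- The invariant is that `h` maps into the same degree and satisfies d h = θ - id on homogeneous
cycles. Applied to the cycle d z, it shows that θ z - z - h(d z) is a cycle, hence a boundary. -/
theorem exists_homotopy (A : FreeStrand K n)
    (θ : ∀ i, A.obj i →ₗ[MvPolynomial (Fin n) K] A.obj i)
    (hθ : ∀ i a, ∀ z ∈ A.gr i a, θ i z ∈ A.gr i a)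
    (hθd : ∀ i a, ∀ z ∈ A.gr (i + 1) a, A.d i (θ (i + 1) z) = θ i (A.d i z))
    (hθ₀ : ∀ a, ∀ z ∈ A.gr 0 a, θ 0 z - z ∈ A.cyc 0) :
    ∃ h : ∀ i, A.obj i →ₗ[MvPolynomial (Fin n) K] A.obj (i + 1),
      (∀ a, ∀ z ∈ A.gr 0 a, A.d 0 (h 0 z) = θ 0 z - z) ∧
      ∀ i a, ∀ z ∈ A.gr (i + 1) a,
        A.d (i + 1) (h (i + 1) z) = θ (i + 1) z - z - h i (A.d i z) := by
  obtain ⟨h₀, hh₀, hh₀d⟩ := (A.free 0).exists_lift (A.smul_mem 1) (A.d 0) (θ 0 - LinearMap.id)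
    (fun a z hz => A.exact 0 a _ (sub_mem (hθ 0 a z hz) hz) (hθ₀ a z hz))
  refine Exists.elim (exists_sequence
    (T := fun i => A.obj i →ₗ[MvPolynomial (Fin n) K] A.obj (i + 1))
    (fun i h => (∀ a, ∀ z ∈ A.gr i a, h z ∈ A.gr (i + 1) a) ∧
      ∀ a, ∀ z ∈ A.gr i a, z ∈ A.cyc i → A.d i (h z) = θ i z - z)
    (fun i h h' => ∀ a, ∀ z ∈ A.gr (i + 1) a,
      A.d (i + 1) (h' z) = θ (i + 1) z - z - h (A.d i z)) h₀
    ⟨hh₀, fun a z hz _ => hh₀d a z hz⟩ ?_)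
    fun h ⟨h0, _, hR⟩ => ⟨h, by rw [h0]; exact hh₀d, hR⟩
  rintro i h ⟨hh, hhd⟩
  obtain ⟨v, hv, hvq⟩ := (A.free (i + 1)).exists_lift (A.smul_mem (i + 2)) (A.d (i + 1))
    (θ (i + 1) - LinearMap.id - h ∘ₗ A.d i) (fun a z hz => by
      have hdz := A.d_mem i a z hz
      refine A.exact (i + 1) a _ (sub_mem (sub_mem (hθ _ a z hz) hz) (hh a _ hdz)) ?_
      rw [A.mem_cyc_succ]
      simp [hθd i a z hz, hhd a _ hdz (A.d_cyc i z)])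
  refine ⟨v, ⟨hv, fun a z hz hc => ?_⟩, hvq⟩
  rw [hvq a z hz]
  simp [(A.mem_cyc_succ i z).1 hc]

/-- The elements `∑ x_i z_i`. -/
def varMul (K : Type u) [Field K] (n : ℕ) (P : Type*) [AddCommGroup P]
    [Module (MvPolynomial (Fin n) K) P] : Submodule (MvPolynomial (Fin n) K) P :=
  Ideal.span (Set.range (X : Fin n → MvPolynomial (Fin n) K)) • ⊤

theorem map_mem_varMul {P Q : Type*} [AddCommGroup P] [AddCommGroup Q]
    [Module (MvPolynomial (Fin n) K) P] [Module (MvPolynomial (Fin n) K) Q]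
    (φ : P →ₗ[MvPolynomial (Fin n) K] Q) {z : P} (hz : z ∈ varMul K n P) :
    φ z ∈ varMul K n Q := by
  have := Submodule.mem_map_of_mem (f := φ) hz
  rw [varMul, Submodule.map_smul''] at this
  exact Submodule.smul_mono le_rfl le_top this

/-- If two free strands resolve the same graded module, and the second one has no generators of
degree `a` in position `i`, then the first one has, after reduction modulo the variables, no homology
of degree `a` in position `i`. -/
theorem exists_sub_mem_varMul (A B : FreeStrand K n)
    (φ₀ : A.obj 0 →ₗ[MvPolynomial (Fin n) K] B.obj 0)
    (hφ₀ : ∀ a, ∀ z ∈ A.gr 0 a, φ₀ z ∈ B.gr 0 a)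
    (hφc : ∀ a, ∀ z ∈ A.gr 0 a, z ∈ A.cyc 0 → φ₀ z ∈ B.cyc 0)
    (ψ₀ : B.obj 0 →ₗ[MvPolynomial (Fin n) K] A.obj 0)
    (hψ₀ : ∀ a, ∀ z ∈ B.gr 0 a, ψ₀ z ∈ A.gr 0 a)
    (hψc : ∀ a, ∀ z ∈ B.gr 0 a, z ∈ B.cyc 0 → ψ₀ z ∈ A.cyc 0)
    (hψφ : ∀ a, ∀ z ∈ A.gr 0 a, ψ₀ (φ₀ z) - z ∈ A.cyc 0)
    (i : ℕ) (a : ℤ) (hB : ∀ y ∈ B.gr i a, y ∈ varMul K n (B.obj i))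
    (z : A.obj i) (hz : z ∈ A.gr i a)
    (hdz : ∀ j (hj : i = j + 1), A.d j (hj ▸ z) ∈ varMul K n (A.obj j)) :
    ∃ w, z - A.d i w ∈ varMul K n (A.obj i) := by
  obtain ⟨φ, rfl, hφ, hφd⟩ := exists_chain_map A B φ₀ hφ₀ hφc
  obtain ⟨ψ, rfl, hψ, hψd⟩ := exists_chain_map B A ψ₀ hψ₀ hψc
  obtain ⟨h, h0, h1⟩ := A.exists_homotopy (fun i => ψ i ∘ₗ φ i)
    (fun i a z hz => hψ i a _ (hφ i a z hz))
    (fun i a z hz => by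
      simp only [LinearMap.comp_apply]
      rw [hψd i a _ (hφ _ a z hz), hφd i a z hz]) hψφ
  -- The only use of `hB`: φ z vanishes modulo the variables, hence so does ψ φ z. The homotopy
  -- relation then presents z as -d(h z) modulo the variables, since h(d z) vanishes there too.
  have hψφz : ψ i (φ i z) ∈ varMul K n (A.obj i) := map_mem_varMul (ψ i) (hB _ (hφ i a z hz))
  obtain _ | i := i
  · refine ⟨-h 0 z, ?_⟩
    rw [map_neg, h0 a z hz]
    simpa using hψφz
  · refine ⟨-h (i + 1) z, ?_⟩
    rw [map_neg, h1 i a z hz]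
    have : h i (A.d i z) ∈ varMul K n (A.obj (i + 1)) := map_mem_varMul (h i) (hdz i rfl)
    convert sub_mem hψφz this using 1
    simp only [LinearMap.comp_apply]
    abel

end FreeStrand

end Comparison

/-! ### Degrees in powers of an equigenerated ideal -/

section Gradings

variable {K : Type u} [Field K] {n m : ℕ}

theorem weight_stdWeight (c : Fin n →₀ ℕ) : Finsupp.weight (stdWeight n) c = (c.degree : ℤ) := by
  simp [Finsupp.weight_apply, stdWeight, Finsupp.degree_apply, Finsupp.sum]

theorem eq_zero_of_weight_stdWeight (c : Fin n →₀ ℕ) (h : Finsupp.weight (stdWeight n) c = 0) :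
    c = 0 := by
  rw [weight_stdWeight] at h
  exact (Finsupp.degree_eq_zero_iff c).1 (by exact_mod_cast h)

theorem weight_biWeight (c : Fin n ⊕ Fin m →₀ ℕ) :
    Finsupp.weight (biWeight n m) c =
      (((∑ i, c (Sum.inl i) : ℕ) : ℤ), ((∑ j, c (Sum.inr j) : ℕ) : ℤ)) := by
  rw [Finsupp.weight_apply, Finsupp.sum_fintype _ _ (by simp), Fintype.sum_sum_type]
  ext <;> simp [biWeight, Prod.fst_sum, Prod.snd_sum]

theorem eq_zero_of_weight_biWeight (c : Fin n ⊕ Fin m →₀ ℕ)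
    (h : Finsupp.weight (biWeight n m) c = 0) : c = 0 := by
  rw [weight_biWeight, Prod.mk_eq_zero] at h
  obtain ⟨h1, h2⟩ := h
  norm_cast at h1 h2
  rw [Finset.sum_eq_zero_iff] at h1 h2
  ext (i | j)
  · exact h1 i (Finset.mem_univ _)
  · exact h2 j (Finset.mem_univ _)

theorem isWeightedHomogeneous_stdWeight_iff {p : MvPolynomial (Fin n) K} {d : ℕ} :
    IsWeightedHomogeneous (stdWeight n) p (d : ℤ) ↔ p.IsHomogeneous d := by
  simp only [IsHomogeneous, IsWeightedHomogeneous, weight_stdWeight, Nat.cast_inj,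
    Finsupp.degree_eq_weight_one]
  rfl

theorem mem_idealGrading {J : Ideal (MvPolynomial (Fin n) K)} {j : ℤ} {z : J} :
    z ∈ idealGrading J j ↔ IsWeightedHomogeneous (stdWeight n) (z : MvPolynomial (Fin n) K) j :=
  Iff.rfl

theorem isGradedModule_idealGrading (J : Ideal (MvPolynomial (Fin n) K)) :
    IsGradedModule (K := K) (stdWeight n) (idealGrading J) where
  smul_mem hp hz := IsWeightedHomogeneous.mul hp hz
  eq_zero_of_sum_eq_zero :=
    eq_zero_of_sum_eq_zero_of_projections _ J.subtype.toAddMonoidHom Subtype.val_injective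
      (fun g => (weightedHomogeneousComponent (stdWeight n) g).toAddMonoidHom.comp
        J.subtype.toAddMonoidHom)
      (fun _ _ hz => (mem_idealGrading.1 hz).weightedHomogeneousComponent_same)
      (fun _ _ hne _ hz => (mem_idealGrading.1 hz).weightedHomogeneousComponent_ne _ hne.symm)

open scoped Pointwise in
theorem exists_span_eq_pow {I : Ideal (MvPolynomial (Fin n) K)} {d : ℕ}
    (hd : IsGeneratedInDegree I d) (k : ℕ) :
    ∃ T : Set (MvPolynomial (Fin n) K), (∀ p ∈ T, p.IsHomogeneous (k * d)) ∧
      I ^ k = Ideal.span T := by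
  induction k with
  | zero => exact ⟨{1}, by simpa using isHomogeneous_one _ _, by simp⟩
  | succ k ih =>
    obtain ⟨T, hT, hk⟩ := ih
    refine ⟨T * {f | f ∈ I ∧ f.IsHomogeneous d}, ?_, ?_⟩
    · rintro _ ⟨p, hp, q, hq, rfl⟩
      rw [add_mul, one_mul]
      exact (hT p hp).mul hq.2
    · rw [pow_succ, hk, ← Ideal.span_mul_span']
      congr 1

theorem nonempty_resolution_pow {I : Ideal (MvPolynomial (Fin n) K)} {d : ℕ}
    (hd : IsGeneratedInDegree I d) (k : ℕ) :
    Nonempty (MinimalGradedFreeResolution K (stdWeight n) (idealGrading (I ^ k))) := by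
  obtain ⟨T, hT, hk⟩ := exists_span_eq_pow hd k
  rw [hk]
  refine nonempty_minimalGradedFreeResolution eq_zero_of_weight_stdWeight
    (isGradedModule_idealGrading _) inferInstance ?_
  rw [eq_top_iff, ← Submodule.span_span_coe_preimage]
  exact Submodule.span_mono fun z hz =>
    ⟨_, isWeightedHomogeneous_stdWeight_iff.2 (hT _ hz)⟩

/-- Elements of a power of an ideal generated in degree `d` have no terms of small degree. -/
theorem le_degree_of_mem_pow {I : Ideal (MvPolynomial (Fin n) K)} {d : ℕ}
    (hd : IsGeneratedInDegree I d) {k : ℕ} {p : MvPolynomial (Fin n) K} (hp : p ∈ I ^ k)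
    {c : Fin n →₀ ℕ} (hc : coeff c p ≠ 0) : k * d ≤ c.degree := by
  -- Generators of degree d put I inside the d-th power of the ideal of the variables, hence I^k
  -- inside its kd-th power.
  have hI : I ≤ idealOfVars (Fin n) K ^ d := by
    rw [IsGeneratedInDegree] at hd
    rw [hd, Ideal.span_le]
    rintro q ⟨-, hq⟩
    rw [SetLike.mem_coe, mem_pow_idealOfVars_iff]
    intro x hx
    have := hq (mem_support_iff.1 hx)
    rw [Finsupp.degree_eq_weight_one]
    exact this.ge
  have := Ideal.pow_right_mono hI k hp
  rw [← pow_mul, mem_pow_idealOfVars_iff] at this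
  rw [mul_comm]
  exact this c (mem_support_iff.2 hc)

theorem le_of_isWeightedHomogeneous_of_mem_pow {I : Ideal (MvPolynomial (Fin n) K)} {d : ℕ}
    (hd : IsGeneratedInDegree I d) {k : ℕ} {p : MvPolynomial (Fin n) K} (hp : p ∈ I ^ k)
    (h0 : p ≠ 0) {j : ℤ} (hj : IsWeightedHomogeneous (stdWeight n) p j) : (k * d : ℤ) ≤ j := by
  obtain ⟨c, hc⟩ := ne_zero_iff.1 h0
  rw [← hj hc, weight_stdWeight]
  exact_mod_cast le_degree_of_mem_pow hd hp hc

/-- Used in both directions to show that a nonzero ideal determines its generating degree, so that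
the degree quantified in `HasLinearPowers` is the given `d`. -/
theorem IsGeneratedInDegree.le {I : Ideal (MvPolynomial (Fin n) K)} (hI : I ≠ ⊥) {d d' : ℕ}
    (hd : IsGeneratedInDegree I d) (hd' : IsGeneratedInDegree I d') : d ≤ d' := by
  by_contra hlt
  apply hI
  rw [IsGeneratedInDegree] at hd'
  rw [hd', Ideal.span_eq_bot]
  rintro q ⟨hqI, hq⟩
  by_contra h0
  have := le_of_isWeightedHomogeneous_of_mem_pow hd (k := 1) (by simpa using hqI) h0
    (isWeightedHomogeneous_stdWeight_iff.2 hq)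
  apply hlt
  exact_mod_cast (by simpa using this : (d : ℤ) ≤ d')

end Gradings

/-! ### The Rees algebra as a bigraded module -/

section ReesGrading

variable {K : Type u} [Field K] {n m : ℕ} {I : Ideal (MvPolynomial (Fin n) K)} {f : Fin m → I}
  {d : ℕ}

theorem mem_reesGrading {g : ℤ × ℤ} {z : ReesModule I f} :
    z ∈ reesGrading I f d g ↔
      (∀ j : ℕ, (j : ℤ) = g.2 →
        IsWeightedHomogeneous (stdWeight n) (reesCoeff I f j z) (j * d + g.1)) ∧
      ∀ j : ℕ, (j : ℤ) ≠ g.2 → reesCoeff I f j z = 0 := by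
  rw [reesGrading, AddSubgroup.mem_iInf, ← forall_and]
  refine forall_congr' fun j => ?_
  rw [AddSubgroup.mem_comap]
  split_ifs with h
  · simp only [h, ne_eq, not_true, false_imp_iff, and_true, true_imp_iff]
    rw [← h]
    rfl
  · simp [h]

/-- An element of the Rees algebra as an element of the module `ReesModule I f`. -/
def ReesModule.mk (f : Fin m → I) (z : reesAlgebra I) : ReesModule I f := z

theorem smul_reesModule (p : MvPolynomial (Fin n ⊕ Fin m) K) (z : reesAlgebra I) :
    p • ReesModule.mk f z = ReesModule.mk f (reesPresentation I f p * z) := rfl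

theorem reesCoeff_mk (j : ℕ) (z : reesAlgebra I) :
    reesCoeff I f j (ReesModule.mk f z) = (z : Polynomial (MvPolynomial (Fin n) K)).coeff j := rfl

theorem reesModule_ext {z z' : ReesModule I f}
    (h : ∀ j, reesCoeff I f j z = reesCoeff I f j z') : z = z' :=
  Subtype.ext (Polynomial.ext h)

theorem mul_mem_reesGrading {g h : ℤ × ℤ} {y z : reesAlgebra I}
    (hy : ReesModule.mk f y ∈ reesGrading I f d g)
    (hz : ReesModule.mk f z ∈ reesGrading I f d h) :
    ReesModule.mk f (y * z) ∈ reesGrading I f d (g + h) := by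
  rw [mem_reesGrading] at hy hz ⊢
  simp only [reesCoeff_mk, Subalgebra.coe_mul, Polynomial.coeff_mul] at hy hz ⊢
  refine ⟨fun j hj => IsWeightedHomogeneous.sum _ _ _ fun x hx => ?_,
    fun j hj => Finset.sum_eq_zero fun x hx => ?_⟩
  · rw [Finset.HasAntidiagonal.mem_antidiagonal] at hx
    by_cases h1 : (x.1 : ℤ) = g.2
    · by_cases h2 : (x.2 : ℤ) = h.2
      · have := (hy.1 _ h1).mul (hz.1 _ h2)
        convert this using 1
        rw [← hx, Prod.fst_add]
        push_cast
        ring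
      · rw [hz.2 _ h2, mul_zero]
        exact isWeightedHomogeneous_zero _ _ _
    · rw [hy.2 _ h1, zero_mul]
      exact isWeightedHomogeneous_zero _ _ _
  · rw [Finset.HasAntidiagonal.mem_antidiagonal] at hx
    by_cases h1 : (x.1 : ℤ) = g.2
    · rw [hz.2 x.2 (fun h2 => hj ?_), mul_zero]
      rw [← hx, Prod.snd_add, ← h1, ← h2]
      push_cast
      rfl
    · rw [hy.2 _ h1, zero_mul]

theorem algebraMap_mem_reesGrading {p : MvPolynomial (Fin n) K} {j : ℤ}
    (hp : IsWeightedHomogeneous (stdWeight n) p j) :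
    ReesModule.mk f (algebraMap _ (reesAlgebra I) p) ∈ reesGrading I f d (j, 0) := by
  rw [mem_reesGrading]
  refine ⟨fun i hi => ?_, fun i hi => ?_⟩
  · obtain rfl : i = 0 := by simpa using hi
    rw [reesCoeff_mk]
    simpa using hp
  · rw [reesCoeff_mk]
    have : i ≠ 0 := by simpa using hi
    simp [Polynomial.coeff_C, this]

theorem reesPresentation_X_inl (i : Fin n) : reesPresentation I f (X (Sum.inl i)) =
    algebraMap (MvPolynomial (Fin n) K) (reesAlgebra I) (X i) := by
  simp [reesPresentation]

theorem coe_reesPresentation_X_inr (j : Fin m) :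
    (reesPresentation I f (X (Sum.inr j)) : Polynomial (MvPolynomial (Fin n) K)) =
      Polynomial.monomial 1 (f j : MvPolynomial (Fin n) K) := by
  simp [reesPresentation]

theorem reesPresentation_rename_inl (s : MvPolynomial (Fin n) K) :
    reesPresentation I f (rename Sum.inl s) = algebraMap _ (reesAlgebra I) s := by
  have : (reesPresentation I f).comp (rename Sum.inl) =
      IsScalarTower.toAlgHom K (MvPolynomial (Fin n) K) (reesAlgebra I) := by
    ext i
    simp [reesPresentation_X_inl]
  exact DFunLike.congr_fun this s

theorem reesPresentation_X_mem (hf : ∀ j, (f j : MvPolynomial (Fin n) K).IsHomogeneous d)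
    (s : Fin n ⊕ Fin m) :
    ReesModule.mk f (reesPresentation I f (X s)) ∈ reesGrading I f d (biWeight n m s) := by
  obtain i | j := s
  · rw [reesPresentation_X_inl]
    exact algebraMap_mem_reesGrading (isWeightedHomogeneous_X K (stdWeight n) i)
  · rw [mem_reesGrading]
    simp only [reesCoeff_mk, coe_reesPresentation_X_inr, biWeight, Sum.elim_inr,
      Polynomial.coeff_monomial]
    refine ⟨fun i hi => ?_, fun i hi => ?_⟩
    · obtain rfl : i = 1 := by exact_mod_cast hi
      simpa using isWeightedHomogeneous_stdWeight_iff.2 (hf j)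
    · rw [if_neg]
      rintro rfl
      exact hi (by simp)

theorem reesPresentation_monomial_mem
    (hf : ∀ j, (f j : MvPolynomial (Fin n) K).IsHomogeneous d) (c : Fin n ⊕ Fin m →₀ ℕ) :
    ∀ r, ReesModule.mk f (reesPresentation I f (monomial c r)) ∈
      reesGrading I f d (Finsupp.weight (biWeight n m) c) := by
  have hC : ∀ r : K, ReesModule.mk f (reesPresentation I f (C r)) ∈ reesGrading I f d 0 := by
    intro r
    rw [← rename_C Sum.inl, reesPresentation_rename_inl]
    exact algebraMap_mem_reesGrading (isWeightedHomogeneous_C _ _)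
  induction c using Finsupp.induction_linear with
  | zero => simpa using hC
  | add a b ha hb =>
    intro r
    rw [map_add, ← mul_one r, ← monomial_mul, map_mul]
    exact mul_mem_reesGrading (ha r) (hb 1)
  | single s k =>
    induction k with
    | zero => simpa using hC
    | succ k ih =>
      intro r
      rw [Finsupp.single_add, map_add, ← mul_one r, ← monomial_mul, map_mul]
      refine mul_mem_reesGrading (ih r) ?_
      have := reesPresentation_X_mem hf s
      rwa [Finsupp.weight_single, one_smul]

theorem reesPresentation_mem (hf : ∀ j, (f j : MvPolynomial (Fin n) K).IsHomogeneous d)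
    {p : MvPolynomial (Fin n ⊕ Fin m) K} {g : ℤ × ℤ}
    (hp : IsWeightedHomogeneous (biWeight n m) p g) :
    ReesModule.mk f (reesPresentation I f p) ∈ reesGrading I f d g := by
  refine IsWeightedHomogeneous.induction_on
    (motive := fun p _ => ReesModule.mk f (reesPresentation I f p) ∈ reesGrading I f d g)
    ?_ ?_ ?_ hp
  · rw [map_zero]
    exact zero_mem _
  · intro p q _ _ hp hq
    rw [map_add]
    exact add_mem hp hq
  · rintro c r rfl
    exact reesPresentation_monomial_mem hf c r

/-- Directness: the projection to bidegree (a, b) takes the component of degree bd + a of the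
coefficient of t^b. -/
theorem isGradedModule_reesGrading
    (hf : ∀ j, (f j : MvPolynomial (Fin n) K).IsHomogeneous d) :
    IsGradedModule (K := K) (biWeight n m) (reesGrading I f d) where
  smul_mem hp hz := mul_mem_reesGrading (reesPresentation_mem hf hp) hz
  eq_zero_of_sum_eq_zero := by
    refine eq_zero_of_sum_eq_zero_of_projections (Q := ℕ → MvPolynomial (Fin n) K) _
      (AddMonoidHom.pi fun j => reesCoeff I f j)
      (fun z z' h => reesModule_ext fun j => congrFun h j)
      (fun g => AddMonoidHom.pi fun j => if (j : ℤ) = g.2 then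
        (weightedHomogeneousComponent (stdWeight n) (j * d + g.1)).toAddMonoidHom.comp
          (reesCoeff I f j) else 0) ?_ ?_
    · intro g z hz
      rw [mem_reesGrading] at hz
      ext1 j
      change (if (j : ℤ) = g.2 then _ else _ : ReesModule I f →+ _) z = reesCoeff I f j z
      split_ifs with h
      · exact (hz.1 j h).weightedHomogeneousComponent_same
      · rw [hz.2 j h]; rfl
    · intro g h hne z hz
      rw [mem_reesGrading] at hz
      ext1 j
      change (if (j : ℤ) = g.2 then _ else _ : ReesModule I f →+ _) z = 0
      split_ifs with hg
      · by_cases hh : (j : ℤ) = h.2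
        · refine (hz.1 j hh).weightedHomogeneousComponent_ne _ fun heq => hne ?_
          exact Prod.ext (by linarith) (by rw [← hh, hg])
        · simp [hz.2 j hh]
      · rfl

theorem reesPresentation_surjective
    (hfI : Ideal.span (Set.range fun j => (f j : MvPolynomial (Fin n) K)) = I) :
    Function.Surjective (reesPresentation I f) := by
  rintro ⟨z, hz⟩
  suffices h : ∃ p, (reesPresentation I f p : Polynomial (MvPolynomial (Fin n) K)) = z by
    obtain ⟨p, hp⟩ := h
    exact ⟨p, Subtype.ext hp⟩
  rw [← adjoin_monomial_eq_reesAlgebra] at hz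
  induction hz using Algebra.adjoin_induction with
  | mem x hx =>
    obtain ⟨r, hr, rfl⟩ := hx
    rw [SetLike.mem_coe, ← hfI] at hr
    induction hr using Submodule.span_induction with
    | mem x hx =>
      obtain ⟨j, rfl⟩ := hx
      exact ⟨X (Sum.inr j), coe_reesPresentation_X_inr j⟩
    | zero => exact ⟨0, by simp⟩
    | add x y _ _ hx hy =>
      obtain ⟨p, hp⟩ := hx
      obtain ⟨q, hq⟩ := hy
      exact ⟨p + q, by rw [map_add, map_add, Subalgebra.coe_add, hp, hq]⟩
    | smul a x _ hx =>
      obtain ⟨p, hp⟩ := hx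
      refine ⟨rename Sum.inl a * p, ?_⟩
      rw [map_mul, map_smul, Subalgebra.coe_mul, hp, reesPresentation_rename_inl,
        Subalgebra.coe_algebraMap, Algebra.smul_def]
  | algebraMap r => exact ⟨rename Sum.inl r, by rw [reesPresentation_rename_inl]; rfl⟩
  | add x y _ _ hx hy =>
    obtain ⟨p, hp⟩ := hx
    obtain ⟨q, hq⟩ := hy
    exact ⟨p + q, by rw [map_add, Subalgebra.coe_add, hp, hq]⟩
  | mul x y _ _ hx hy =>
    obtain ⟨p, hp⟩ := hx
    obtain ⟨q, hq⟩ := hy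
    exact ⟨p * q, by rw [map_mul, Subalgebra.coe_mul, hp, hq]⟩

/-- By surjectivity of the presentation, the Rees algebra is a cyclic module, generated by 1 in
bidegree (0, 0). -/
theorem nonempty_resolution_rees (hf : ∀ j, (f j : MvPolynomial (Fin n) K).IsHomogeneous d)
    (hfI : Ideal.span (Set.range fun j => (f j : MvPolynomial (Fin n) K)) = I) :
    Nonempty (MinimalGradedFreeResolution K (biWeight n m) (reesGrading I f d)) := by
  have htop : Submodule.span (MvPolynomial (Fin n ⊕ Fin m) K) {ReesModule.mk f 1} = ⊤ := by
    rw [eq_top_iff]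
    intro z _
    obtain ⟨p, hp⟩ := reesPresentation_surjective hfI z
    refine Submodule.mem_span_singleton.2 ⟨p, ?_⟩
    rw [smul_reesModule, mul_one, hp]
    rfl
  refine nonempty_minimalGradedFreeResolution eq_zero_of_weight_biWeight
    (isGradedModule_reesGrading hf) ⟨⟨{ReesModule.mk f 1}, by simpa using htop⟩⟩ ?_
  rw [eq_top_iff, ← htop]
  refine Submodule.span_mono ?_
  rw [Set.singleton_subset_iff]
  refine ⟨0, ?_⟩
  have := algebraMap_mem_reesGrading (f := f) (d := d) (isWeightedHomogeneous_one K (stdWeight n))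
  rwa [map_one] at this

end ReesGrading

/-! ### Homogeneous exactness and consequences of minimality -/

namespace MinimalGradedFreeResolution

variable {K : Type u} [Field K] {σ : Type v} {G : Type} [AddCommGroup G]
  {M : Type w} [AddCommGroup M] [Module (MvPolynomial σ K) M] {wt : σ → G}
  {ℳ : G → AddSubgroup M}

/-- The cycles of a resolution, where the augmentation is regarded as the last differential. -/
def cycles (F : MinimalGradedFreeResolution K wt ℳ) :
    ∀ i, Submodule (MvPolynomial σ K) (Fin (F.rank i) → MvPolynomial σ K)
  | 0 => LinearMap.ker F.ε
  | i + 1 => LinearMap.ker (F.d i)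

theorem range_d (F : MinimalGradedFreeResolution K wt ℳ) (i : ℕ) :
    LinearMap.range (F.d i) = F.cycles i := by
  cases i with
  | zero => exact (LinearMap.exact_iff.1 F.exact_zero).symm
  | succ i => exact (LinearMap.exact_iff.1 (F.exact_succ i)).symm

theorem d_single_mem (F : MinimalGradedFreeResolution K wt ℳ) (i : ℕ) (e) :
    F.d i (Pi.single e 1) ∈ freeGrading K wt (F.deg i) (F.deg (i + 1) e) :=
  F.d_homogeneous i e

theorem d_mem (F : MinimalGradedFreeResolution K wt ℳ) (i : ℕ) {g : G}
    {z : Fin (F.rank (i + 1)) → MvPolynomial σ K}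
    (hz : z ∈ freeGrading K wt (F.deg (i + 1)) g) : F.d i z ∈ freeGrading K wt (F.deg i) g :=
  (isGradedModule_freeGrading wt (F.deg i)).map_mem (F.d_single_mem i) hz

theorem exists_d_eq (F : MinimalGradedFreeResolution K wt ℳ) (i : ℕ) {g : G}
    {z : Fin (F.rank i) → MvPolynomial σ K} (hz : z ∈ freeGrading K wt (F.deg i) g)
    (hc : z ∈ F.cycles i) : ∃ w ∈ freeGrading K wt (F.deg (i + 1)) g, F.d i w = z := by
  rw [← F.range_d] at hc
  obtain ⟨w, rfl⟩ := hc
  exact ⟨_, freeComponent_mem _ _ _ _,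
    (isGradedModule_freeGrading wt (F.deg i)).map_freeComponent (F.d_single_mem i) hz⟩

theorem exists_ε_eq (hM : IsGradedModule (K := K) wt ℳ) (F : MinimalGradedFreeResolution K wt ℳ)
    {g : G} {x : M} (hx : x ∈ ℳ g) : ∃ z ∈ freeGrading K wt (F.deg 0) g, F.ε z = x := by
  obtain ⟨z, rfl⟩ := F.ε_surjective x
  exact ⟨_, freeComponent_mem _ _ _ _, hM.map_freeComponent F.ε_homogeneous hx⟩

theorem constantCoeff_d (F : MinimalGradedFreeResolution K wt ℳ) (i : ℕ) (z)
    (e : Fin (F.rank i)) : constantCoeff (F.d i z e) = 0 := by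
  rw [linearMap_apply_eq_sum, Finset.sum_apply, map_sum]
  refine Finset.sum_eq_zero fun e' _ => ?_
  rw [Pi.smul_apply, smul_eq_mul, map_mul, mem_span_range_X_iff.1 (F.minimal i e' e), mul_zero]

/-- Cycles are boundaries, and minimality leaves boundaries without constant terms, whereas a basis
vector has the entry 1. -/
theorem single_notMem_cycles (F : MinimalGradedFreeResolution K wt ℳ) (i : ℕ)
    (e : Fin (F.rank i)) : Pi.single e 1 ∉ F.cycles i := by
  intro h
  rw [← F.range_d] at h
  obtain ⟨w, hw⟩ := h
  have := F.constantCoeff_d i w e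
  rw [hw, Pi.single_eq_same, map_one] at this
  exact one_ne_zero this

theorem rank_zero_ne_zero [Nontrivial M] (F : MinimalGradedFreeResolution K wt ℳ) :
    F.rank 0 ≠ 0 := by
  intro h
  have : IsEmpty (Fin (F.rank 0)) := by rw [h]; infer_instance
  have := F.ε_surjective.subsingleton
  exact not_subsingleton M this

end MinimalGradedFreeResolution

/-! ### Resolutions over K[x] as strands -/

section StandardStrand

variable {K : Type u} [Field K] {n : ℕ}

open FreeStrand

theorem isGradedFree_freeGrading {r : ℕ} (deg : Fin r → ℤ) (c : ℤ) :
    IsGradedFree K n fun a => freeGrading K (stdWeight n) deg (a + c) := by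
  refine ⟨Fin r, Pi.basisFun _ _, fun e => deg e - c, Set.univ, fun e _ => ?_, fun a z hz => ?_⟩
  · simpa using single_mem_freeGrading (K := K) (stdWeight n) deg e
  · have := linearMap_apply_eq_sum (LinearMap.id (M := Fin r → MvPolynomial (Fin n) K)) z
    rw [LinearMap.id_apply] at this
    rw [this]
    refine sum_mem fun e _ => AddSubgroup.subset_closure ⟨e, trivial, z e, ?_, by simp⟩
    have h := mem_freeGrading.1 hz e
    rwa [show a + c - deg e = a - (deg e - c) by ring] at h

theorem mem_varMul_of_constantCoeff {r : ℕ} {z : Fin r → MvPolynomial (Fin n) K}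
    (hz : ∀ e, constantCoeff (z e) = 0) : z ∈ varMul K n (Fin r → MvPolynomial (Fin n) K) := by
  have := linearMap_apply_eq_sum (LinearMap.id (M := Fin r → MvPolynomial (Fin n) K)) z
  rw [LinearMap.id_apply] at this
  rw [this]
  exact sum_mem fun e _ => Submodule.smul_mem_smul (mem_span_range_X_iff.2 (hz e)) trivial

theorem constantCoeff_of_mem_varMul {r : ℕ} {z : Fin r → MvPolynomial (Fin n) K}
    (hz : z ∈ varMul K n (Fin r → MvPolynomial (Fin n) K)) (e : Fin r) :
    constantCoeff (z e) = 0 := by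
  refine Submodule.smul_induction_on (p := fun z => constantCoeff (z e) = 0) hz ?_ ?_
  · intro s hs y _
    rw [Pi.smul_apply, smul_eq_mul, map_mul, mem_span_range_X_iff.1 hs, zero_mul]
  · intro x y hx hy
    rw [Pi.add_apply, map_add, hx, hy, add_zero]

/-- A nonzero constant term in the entry at `e` would force `deg e = a`. -/
theorem mem_varMul_of_mem_freeGrading {r : ℕ} {deg : Fin r → ℤ} {a : ℤ} (ha : ∀ e, deg e ≠ a)
    {z : Fin r → MvPolynomial (Fin n) K} (hz : z ∈ freeGrading K (stdWeight n) deg a) :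
    z ∈ varMul K n (Fin r → MvPolynomial (Fin n) K) := by
  refine mem_varMul_of_constantCoeff fun e => ?_
  rw [constantCoeff_eq]
  refine (hz e).coeff_eq_zero 0 ?_
  rw [map_zero]
  exact fun h => ha e (sub_eq_zero.1 h.symm).symm

/-- A graded free resolution over `K[x_1, …, x_n]`, with degrees shifted by `c`. -/
def MinimalGradedFreeResolution.toStrand {M : Type w} [AddCommGroup M]
    [Module (MvPolynomial (Fin n) K) M] {ℳ : ℤ → AddSubgroup M}
    (F : MinimalGradedFreeResolution K (stdWeight n) ℳ) (c : ℤ) : FreeStrand K n where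
  obj i := Fin (F.rank i) → MvPolynomial (Fin n) K
  gr i a := freeGrading K (stdWeight n) (F.deg i) (a + c)
  d := F.d
  cyc := F.cycles
  smul_mem i s w a z hs hz := by
    rw [add_assoc]
    exact (isGradedModule_freeGrading _ _).smul_mem hs hz
  d_mem i a z hz := F.d_mem i hz
  d_cyc i z := by rw [← F.range_d]; exact LinearMap.mem_range_self _ _
  mem_cyc_succ i z := Iff.rfl
  exact i a z hz hc := F.exists_d_eq i hz hc
  free i := isGradedFree_freeGrading _ _

end StandardStrand

/-! ### Strands of bigraded resolutions in a fixed second degree -/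

section BigradedStrand

variable {K : Type u} [Field K] {n m : ℕ}

open FreeStrand

/-- `K[x_1, …, x_n, y_1, …, y_m]` as an algebra over `K[x_1, …, x_n]`. -/
instance algebraOfInl :
    Algebra (MvPolynomial (Fin n) K) (MvPolynomial (Fin n ⊕ Fin m) K) :=
  (rename Sum.inl : MvPolynomial (Fin n) K →ₐ[K] MvPolynomial (Fin n ⊕ Fin m) K).toAlgebra

theorem smul_eq_rename_mul (s : MvPolynomial (Fin n) K) (p : MvPolynomial (Fin n ⊕ Fin m) K) :
    s • p = rename Sum.inl s * p := rfl

/-- The monomials in `y_1, …, y_m` form a basis of `K[x_1, …, x_n, y_1, …, y_m]` over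
`K[x_1, …, x_n]`. -/
theorem exists_basis_inr : ∃ b : Module.Basis (Fin m →₀ ℕ) (MvPolynomial (Fin n) K)
    (MvPolynomial (Fin n ⊕ Fin m) K), ∀ c, b c = rename Sum.inr (monomial c 1) := by
  -- The two blocks of variables are swapped so that y becomes the outer block, with coefficients in
  -- K[x].
  let E : MvPolynomial (Fin n ⊕ Fin m) K ≃ₐ[K] MvPolynomial (Fin m) (MvPolynomial (Fin n) K) :=
    (renameEquiv K (Equiv.sumComm _ _)).trans (sumAlgEquiv K (Fin m) (Fin n))
  have hinl : ∀ s, E (rename Sum.inl s) = C s := by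
    intro s
    have : E.toAlgHom.comp (rename Sum.inl) =
        IsScalarTower.toAlgHom K (MvPolynomial (Fin n) K) (MvPolynomial (Fin m) _) := by
      ext i
      simp [E]
    exact DFunLike.congr_fun this s
  have hinr : ∀ s, E (rename Sum.inr s) = map C s := by
    intro s
    have : E.toAlgHom.comp (rename Sum.inr) =
        mapAlgHom (IsScalarTower.toAlgHom K K (MvPolynomial (Fin n) K)) := by
      ext i
      simp [E]
    exact DFunLike.congr_fun this s
  let E' : MvPolynomial (Fin n ⊕ Fin m) K ≃ₗ[MvPolynomial (Fin n) K]
      MvPolynomial (Fin m) (MvPolynomial (Fin n) K) :=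
    { E with
      map_smul' := fun s p => by
        change E (rename Sum.inl s * p) = s • E p
        rw [map_mul, hinl, smul_eq_C_mul] }
  refine ⟨(basisMonomials (Fin m) (MvPolynomial (Fin n) K)).map E'.symm, fun c => ?_⟩
  rw [Module.Basis.map_apply, LinearEquiv.symm_apply_eq, coe_basisMonomials]
  change _ = E _
  rw [hinr, map_monomial, map_one]

theorem monomial_sum_eq_smul (c : Fin n ⊕ Fin m →₀ ℕ) (r : K) :
    monomial c r = (monomial (c.comapDomain Sum.inl Sum.inl_injective.injOn) r :
      MvPolynomial (Fin n) K) • (rename Sum.inr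
        (monomial (c.comapDomain Sum.inr Sum.inr_injective.injOn) (1 : K)) :
        MvPolynomial (Fin n ⊕ Fin m) K) := by
  rw [smul_eq_rename_mul, rename_monomial, rename_monomial, monomial_mul, mul_one]
  refine congrArg (fun c => monomial c r) (Finsupp.ext ?_)
  rintro (i | j)
  · rw [Finsupp.add_apply, Finsupp.mapDomain_apply Sum.inl_injective,
      Finsupp.mapDomain_of_notMem_range _ _ (by simp)]
    simp
  · rw [Finsupp.add_apply, Finsupp.mapDomain_apply Sum.inr_injective,
      Finsupp.mapDomain_of_notMem_range _ _ (by simp)]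
    simp

theorem isWeightedHomogeneous_rename_inl {s : MvPolynomial (Fin n) K} {w : ℤ}
    (hs : IsWeightedHomogeneous (stdWeight n) s w) :
    IsWeightedHomogeneous (biWeight n m) (rename Sum.inl s) (w, 0) := by
  intro c hc
  obtain ⟨c', rfl, hc'⟩ := coeff_rename_ne_zero _ _ _ hc
  have := hs hc'
  rw [Finsupp.weight_apply, Finsupp.sum_mapDomain_index (by simp) (by simp [add_smul])]
  rw [Finsupp.weight_apply] at this
  rw [← this]
  ext <;> simp [biWeight, stdWeight, Finsupp.sum, Prod.fst_sum, Prod.snd_sum]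

theorem pi_single_mem_of_isWeightedHomogeneous {r : ℕ} (e : Fin r) {g : ℤ × ℤ}
    (H : AddSubgroup (Fin r → MvPolynomial (Fin n ⊕ Fin m) K))
    (hH : ∀ (c : Fin n ⊕ Fin m →₀ ℕ) (t : K), Finsupp.weight (biWeight n m) c = g →
      Pi.single e (monomial c t) ∈ H) {p : MvPolynomial (Fin n ⊕ Fin m) K}
    (hp : IsWeightedHomogeneous (biWeight n m) p g) : Pi.single e p ∈ H := by
  refine IsWeightedHomogeneous.induction_on (motive := fun p _ => Pi.single e p ∈ H) ?_ ?_ ?_ hp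
  · rw [Pi.single_zero]
    exact zero_mem _
  · intro p q _ _ hp hq
    rw [Pi.single_add]
    exact add_mem hp hq
  · intro c t hc
    exact hH c t hc

theorem isGradedFree_freeGrading_strand {r : ℕ} (deg : Fin r → ℤ × ℤ) (k : ℤ) :
    IsGradedFree K n fun a => freeGrading K (biWeight n m) deg (a, k) := by
  obtain ⟨b, hb⟩ := exists_basis_inr (K := K) (n := n) (m := m)
  have hbe : ∀ e c, Pi.basis (fun _ : Fin r => b) ⟨e, c⟩ = Pi.single e (rename Sum.inr
      (monomial c 1)) := fun e c => by rw [Pi.basis_apply, hb]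
  -- The basis element y^c e has bidegree `deg e` + (0, |c|). Its first degree is that of `e`, and
  -- `J` selects the elements of second degree `k` from the basis of the whole module.
  refine ⟨_, Pi.basis fun _ : Fin r => b, fun j => (deg j.1).1,
    {j | (deg j.1).2 + ((∑ i, j.2 i : ℕ) : ℤ) = k}, ?_, ?_⟩
  · rintro ⟨e, c⟩ hj e'
    rw [hbe]
    rcases eq_or_ne e' e with rfl | hne
    · rw [Pi.single_eq_same, rename_monomial]
      refine isWeightedHomogeneous_monomial _ _ _ ?_
      rw [weight_biWeight]
      simp only [Finsupp.mapDomain_apply Sum.inr_injective]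
      have hj' : (deg e').2 + ((∑ i, c i : ℕ) : ℤ) = k := hj
      ext
      · simp [Finsupp.mapDomain_of_notMem_range]
      · simp [← hj']
    · rw [Pi.single_eq_of_ne hne]
      exact isWeightedHomogeneous_zero _ _ _
  · intro a z hz
    rw [← Finset.univ_sum_single z]
    refine sum_mem fun e _ => pi_single_mem_of_isWeightedHomogeneous e _ ?_ (hz e)
    intro c t hc
    rw [weight_biWeight] at hc
    refine AddSubgroup.subset_closure ⟨⟨e, c.comapDomain Sum.inr Sum.inr_injective.injOn⟩, ?_,
      monomial (c.comapDomain Sum.inl Sum.inl_injective.injOn) t, ?_, ?_⟩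
    · have := congrArg Prod.snd hc
      simp only [Prod.snd_sub] at this
      change (deg e).2 + ((∑ i, c (Sum.inr i) : ℕ) : ℤ) = k
      rw [this]
      ring
    · refine isWeightedHomogeneous_monomial _ _ _ ?_
      have := congrArg Prod.fst hc
      rw [weight_stdWeight, Finsupp.degree_eq_sum]
      simpa using this
    · rw [hbe, monomial_sum_eq_smul, Pi.single_smul]

theorem constantCoeff_of_mem_varMul_inl {r : ℕ} {z : Fin r → MvPolynomial (Fin n ⊕ Fin m) K}
    (hz : z ∈ varMul K n (Fin r → MvPolynomial (Fin n ⊕ Fin m) K)) (e : Fin r) :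
    constantCoeff (z e) = 0 := by
  refine Submodule.smul_induction_on (p := fun z => constantCoeff (z e) = 0) hz ?_ ?_
  · intro s hs y _
    rw [Pi.smul_apply, smul_eq_rename_mul, map_mul, constantCoeff_rename,
      mem_span_range_X_iff.1 hs, zero_mul]
  · intro x y hx hy
    rw [Pi.add_apply, map_add, hx, hy, add_zero]

/-- The entry at `e` is homogeneous of nonzero x-degree a - (deg e).1, so each of its monomials
contains some x-variable. The factor in y plays no role. -/
theorem mem_varMul_of_mem_freeGrading_strand {r : ℕ} {deg : Fin r → ℤ × ℤ} {a k : ℤ}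
    (ha : ∀ e, (deg e).1 ≠ a) {z : Fin r → MvPolynomial (Fin n ⊕ Fin m) K}
    (hz : z ∈ freeGrading K (biWeight n m) deg (a, k)) :
    z ∈ varMul K n (Fin r → MvPolynomial (Fin n ⊕ Fin m) K) := by
  rw [← Finset.univ_sum_single z]
  refine sum_mem fun e _ => pi_single_mem_of_isWeightedHomogeneous e
    (varMul K n (Fin r → MvPolynomial (Fin n ⊕ Fin m) K)).toAddSubgroup ?_ (hz e)
  intro c t hc
  rw [weight_biWeight] at hc
  rw [monomial_sum_eq_smul, Pi.single_smul]
  refine Submodule.smul_mem_smul (mem_span_range_X_iff.2 ?_) trivial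
  rw [constantCoeff_eq, coeff_monomial, if_neg]
  intro h0
  have h1 := congrArg Prod.fst hc
  have h2 : ∀ i, c (Sum.inl i) = 0 := fun i => DFunLike.congr_fun h0 i
  simp only [h2, Finset.sum_const_zero, Nat.cast_zero, Prod.fst_sub] at h1
  exact ha e (by linarith)

/-- The part of second degree `k` of a bigraded free resolution over
`K[x_1, …, x_n, y_1, …, y_m]`, as a resolution over `K[x_1, …, x_n]`. -/
def MinimalGradedFreeResolution.toBigradedStrand {M : Type w} [AddCommGroup M]
    [Module (MvPolynomial (Fin n ⊕ Fin m) K) M] {ℳ : ℤ × ℤ → AddSubgroup M}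
    (F : MinimalGradedFreeResolution K (biWeight n m) ℳ) (k : ℤ) : FreeStrand K n where
  obj i := Fin (F.rank i) → MvPolynomial (Fin n ⊕ Fin m) K
  gr i a := freeGrading K (biWeight n m) (F.deg i) (a, k)
  d i := (F.d i).restrictScalars _
  cyc i := (F.cycles i).restrictScalars _
  smul_mem i s w a z hs hz := by
    have := (isGradedModule_freeGrading _ _).smul_mem (isWeightedHomogeneous_rename_inl hs) hz
    rwa [Prod.mk_add_mk, zero_add] at this
  d_mem i a z hz := F.d_mem i hz
  d_cyc i z := by
    rw [Submodule.restrictScalars_mem, ← F.range_d]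
    exact LinearMap.mem_range_self _ _
  mem_cyc_succ i z := Iff.rfl
  exact i a z hz hc := F.exists_d_eq i hz hc
  free i := isGradedFree_freeGrading_strand _ _

end BigradedStrand

/-! ### Comparing the strands of the Rees algebra with the powers of I -/

section ReesComparison

variable {K : Type u} [Field K] {n m : ℕ} {I : Ideal (MvPolynomial (Fin n) K)} {f : Fin m → I}
  {d : ℕ}

open FreeStrand

/-- The Rees algebra as a module over `K[x_1, …, x_n]`. -/
instance reesModuleOfInl : Module (MvPolynomial (Fin n) K) (ReesModule I f) :=
  Module.compHom _ (algebraMap (MvPolynomial (Fin n) K) (MvPolynomial (Fin n ⊕ Fin m) K))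

theorem smul_reesModule_inl (s : MvPolynomial (Fin n) K) (z : reesAlgebra I) :
    s • ReesModule.mk f z = ReesModule.mk f (algebraMap _ (reesAlgebra I) s * z) := by
  rw [← reesPresentation_rename_inl (f := f), ← smul_reesModule]
  rfl

theorem reesCoeff_smul_mk (j : ℕ) (s : MvPolynomial (Fin n) K) (z : reesAlgebra I) :
    reesCoeff I f j (s • ReesModule.mk f z) = s * reesCoeff I f j (ReesModule.mk f z) := by
  rw [smul_reesModule_inl, reesCoeff_mk, reesCoeff_mk]
  simp [Polynomial.coeff_C_mul]

theorem reesCoeff_smul (j : ℕ) (s : MvPolynomial (Fin n) K) (z : ReesModule I f) :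
    reesCoeff I f j (s • z) = s * reesCoeff I f j z :=
  reesCoeff_smul_mk j s z

theorem reesCoeff_mem (j : ℕ) (z : ReesModule I f) : reesCoeff I f j z ∈ I ^ j :=
  (mem_reesAlgebra_iff I _).1 (Subtype.property (p := (· ∈ reesAlgebra I)) z) j

/-- The embedding of `I ^ k` into the Rees algebra. -/
def powToRees (f : Fin m → I) (k : ℕ) :
    ↥(I ^ k) →ₗ[MvPolynomial (Fin n) K] ReesModule I f where
  toFun x := ReesModule.mk f ⟨Polynomial.monomial k (x : MvPolynomial (Fin n) K),
    reesAlgebra.monomial_mem.2 x.2⟩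
  map_add' x y := Subtype.ext ((Polynomial.monomial k).map_add _ _)
  map_smul' s x := by
    refine reesModule_ext fun j => ?_
    rw [RingHom.id_apply, reesCoeff_smul, reesCoeff_mk, reesCoeff_mk]
    simp [Polynomial.coeff_monomial]

theorem reesCoeff_powToRees (k j : ℕ) (x : ↥(I ^ k)) :
    reesCoeff I f j (powToRees f k x) = if k = j then (x : MvPolynomial (Fin n) K) else 0 :=
  Polynomial.coeff_monomial

/-- The projection of the Rees algebra onto `I ^ k`. -/
def reesToPow (f : Fin m → I) (k : ℕ) :
    ReesModule I f →ₗ[MvPolynomial (Fin n) K] ↥(I ^ k) where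
  toFun z := ⟨reesCoeff I f k z, reesCoeff_mem k z⟩
  map_add' _ _ := Subtype.ext (map_add _ _ _)
  map_smul' s z := Subtype.ext (reesCoeff_smul k s z)

theorem reesToPow_powToRees (k : ℕ) (x : ↥(I ^ k)) : reesToPow f k (powToRees f k x) = x :=
  Subtype.ext ((reesCoeff_powToRees (f := f) k k x).trans (if_pos rfl))

theorem powToRees_reesToPow {k : ℕ} {a : ℤ} {z : ReesModule I f}
    (hz : z ∈ reesGrading I f d (a, k)) : powToRees f k (reesToPow f k z) = z := by
  refine reesModule_ext fun j => ?_
  rw [reesCoeff_powToRees]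
  split_ifs with h
  · rw [← h]
    rfl
  · exact ((mem_reesGrading.1 hz).2 j (by simpa using fun h' => h h'.symm)).symm

theorem powToRees_mem {k : ℕ} {a : ℤ} {x : ↥(I ^ k)}
    (hx : x ∈ idealGrading (I ^ k) (a + k * d)) : powToRees f k x ∈ reesGrading I f d (a, k) := by
  rw [mem_reesGrading]
  refine ⟨fun j hj => ?_, fun j hj => ?_⟩
  · obtain rfl : j = k := by simpa using hj
    rw [reesCoeff_powToRees, if_pos rfl, add_comm]
    exact hx
  · rw [reesCoeff_powToRees, if_neg]
    rintro rfl
    exact hj rfl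

theorem reesToPow_mem {k : ℕ} {a : ℤ} {z : ReesModule I f}
    (hz : z ∈ reesGrading I f d (a, k)) : reesToPow f k z ∈ idealGrading (I ^ k) (a + k * d) := by
  rw [mem_idealGrading, add_comm]
  exact (mem_reesGrading.1 hz).1 k rfl

/-- The augmentation of a resolution of the Rees algebra as a map over `K[x_1, …, x_n]`. -/
def reesAugmentation (F : MinimalGradedFreeResolution K (biWeight n m) (reesGrading I f d)) :
    (Fin (F.rank 0) → MvPolynomial (Fin n ⊕ Fin m) K) →ₗ[MvPolynomial (Fin n) K]
      ReesModule I f where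
  toFun := F.ε
  map_add' := map_add F.ε
  map_smul' s z := F.ε.map_smul (rename Sum.inl s) z

theorem exists_lift_powToRees
    (hf : ∀ j, (f j : MvPolynomial (Fin n) K).IsHomogeneous d)
    (F : MinimalGradedFreeResolution K (biWeight n m) (reesGrading I f d)) {k : ℕ}
    (L : MinimalGradedFreeResolution K (stdWeight n) (idealGrading (I ^ k))) :
    ∃ φ : (L.toStrand (k * d)).obj 0 →ₗ[MvPolynomial (Fin n) K] (F.toBigradedStrand k).obj 0,
      (∀ a, ∀ z ∈ (L.toStrand (k * d)).gr 0 a, φ z ∈ (F.toBigradedStrand k).gr 0 a) ∧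
      ∀ a, ∀ z ∈ (L.toStrand (k * d)).gr 0 a, F.ε (φ z) = powToRees f k (L.ε z) :=
  ((L.toStrand (k * d)).free 0).exists_lift ((F.toBigradedStrand k).smul_mem 0)
    (reesAugmentation F) (powToRees f k ∘ₗ L.ε) fun _ _ hz =>
      F.exists_ε_eq (isGradedModule_reesGrading hf) (powToRees_mem
        ((isGradedModule_idealGrading (I ^ k)).map_mem L.ε_homogeneous hz))

theorem exists_lift_reesToPow
    (hf : ∀ j, (f j : MvPolynomial (Fin n) K).IsHomogeneous d)
    (F : MinimalGradedFreeResolution K (biWeight n m) (reesGrading I f d)) {k : ℕ}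
    (L : MinimalGradedFreeResolution K (stdWeight n) (idealGrading (I ^ k))) :
    ∃ ψ : (F.toBigradedStrand k).obj 0 →ₗ[MvPolynomial (Fin n) K] (L.toStrand (k * d)).obj 0,
      (∀ a, ∀ z ∈ (F.toBigradedStrand k).gr 0 a, ψ z ∈ (L.toStrand (k * d)).gr 0 a) ∧
      ∀ a, ∀ z ∈ (F.toBigradedStrand k).gr 0 a, L.ε (ψ z) = reesToPow f k (F.ε z) :=
  ((F.toBigradedStrand k).free 0).exists_lift ((L.toStrand (k * d)).smul_mem 0)
    L.ε (reesToPow f k ∘ₗ reesAugmentation F) fun _ _ hz =>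
      L.exists_ε_eq (isGradedModule_idealGrading _) (reesToPow_mem
        ((isGradedModule_reesGrading hf).map_mem F.ε_homogeneous hz))

/-- Bounds for the first degrees in a resolution of the Rees algebra yield bounds for the degrees in
the resolutions of the powers. -/
theorem deg_pow_le (hf : ∀ j, (f j : MvPolynomial (Fin n) K).IsHomogeneous d)
    (F : MinimalGradedFreeResolution K (biWeight n m) (reesGrading I f d))
    (hF : ∀ i e, (F.deg i e).1 ≤ i) {k : ℕ}
    (L : MinimalGradedFreeResolution K (stdWeight n) (idealGrading (I ^ k))) (i : ℕ)
    (e : Fin (L.rank i)) : L.deg i e ≤ i + k * d := by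
  by_contra hlt
  rw [not_le] at hlt
  obtain ⟨φ, hφ, hφε⟩ := exists_lift_powToRees hf F L
  obtain ⟨ψ, hψ, hψε⟩ := exists_lift_reesToPow hf F L
  obtain ⟨w, hw⟩ := exists_sub_mem_varMul (L.toStrand (k * d)) (F.toBigradedStrand k)
    φ hφ (fun a z hz hc => by
      have hc' : L.ε z = 0 := hc
      change F.ε (φ z) = 0
      rw [hφε a z hz, hc', map_zero])
    ψ hψ (fun a z hz hc => by
      have hc' : F.ε z = 0 := hc
      change L.ε (ψ z) = 0
      rw [hψε a z hz, hc', map_zero])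
    (fun a z hz => by
      refine (L.ε.map_sub _ _).trans (sub_eq_zero.2 ?_)
      rw [hψε a _ (hφ a z hz), hφε a z hz, reesToPow_powToRees])
    -- The strand degree of the basis vector `e` after the shift by kd. By `hlt` it exceeds `i`, so
    -- by `hF` no basis vector of F_i has it as first degree.
    i (L.deg i e - k * d)
    (fun y hy => mem_varMul_of_mem_freeGrading_strand
      (fun e' he' => by have := hF i e'; omega) hy)
    (Pi.single e 1) (by
      change _ ∈ freeGrading K (stdWeight n) (L.deg i) _
      rw [sub_add_cancel]
      exact single_mem_freeGrading _ _ _)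
    (by
      rintro j rfl
      exact mem_varMul_of_constantCoeff fun e' => L.constantCoeff_d j _ e')
  have h1 := constantCoeff_of_mem_varMul hw e
  have h2 : constantCoeff (L.d i w e) = 0 := L.constantCoeff_d i w e
  change constantCoeff ((Pi.single e 1 : Fin (L.rank i) → MvPolynomial (Fin n) K) e - L.d i w e) = 0
    at h1
  rw [map_sub, h2, Pi.single_eq_same, map_one, sub_zero] at h1
  exact one_ne_zero h1

theorem nonneg_of_ne_zero_of_mem_reesGrading (hd : IsGeneratedInDegree I d) {g : ℤ × ℤ}
    {z : ReesModule I f} (hz : z ∈ reesGrading I f d g) (h0 : z ≠ 0) : 0 ≤ g.1 ∧ 0 ≤ g.2 := by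
  rw [mem_reesGrading] at hz
  obtain ⟨j, hj⟩ : ∃ j, reesCoeff I f j z ≠ 0 := by
    by_contra! h
    exact h0 (reesModule_ext fun j => by rw [h j, map_zero])
  have hj2 : (j : ℤ) = g.2 := by
    by_contra h
    exact hj (hz.2 j h)
  have := le_of_isWeightedHomogeneous_of_mem_pow hd (reesCoeff_mem j z) hj (hz.1 j hj2)
  exact ⟨by linarith, by omega⟩

/-- A basis vector has nonzero image in the preceding module. A nonzero entry of that image has
nonnegative second degree, so second degrees cannot drop below those in the previous position. This
makes the second degree of a basis vector an exponent of a power of I. -/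
theorem deg_rees_snd_nonneg (hd : IsGeneratedInDegree I d)
    (F : MinimalGradedFreeResolution K (biWeight n m) (reesGrading I f d)) (i : ℕ)
    (e : Fin (F.rank i)) : 0 ≤ (F.deg i e).2 := by
  induction i with
  | zero =>
    exact (nonneg_of_ne_zero_of_mem_reesGrading hd (F.ε_homogeneous e)
      (F.single_notMem_cycles 0 e)).2
  | succ i ih =>
    obtain ⟨e', he'⟩ := Function.ne_iff.1
      (show F.d i (Pi.single e 1) ≠ 0 from F.single_notMem_cycles (i + 1) e)
    obtain ⟨c, hc⟩ := ne_zero_iff.1 he'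
    have h := congrArg Prod.snd (F.d_homogeneous i e e' hc)
    rw [weight_biWeight, Prod.snd_sub] at h
    have := ih e'
    have h' : (0 : ℤ) ≤ ((∑ j, c (Sum.inr j) : ℕ) : ℤ) := Nat.cast_nonneg _
    simp only at h
    linarith

/-- The inductive step for a fixed first degree `a`: `hprev` makes a basis vector of first degree
`a` a cycle modulo x. Some such hypothesis is needed because a differential that is minimal over A
may still have entries purely in y, which survive modulo x. -/
theorem deg_rees_ne (hd : IsGeneratedInDegree I d)
    (hf : ∀ j, (f j : MvPolynomial (Fin n) K).IsHomogeneous d)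
    (F : MinimalGradedFreeResolution K (biWeight n m) (reesGrading I f d))
    (L : ∀ k : ℕ, MinimalGradedFreeResolution K (stdWeight n) (idealGrading (I ^ k)))
    (hL : ∀ (k i : ℕ) (e), (L k).deg i e ≤ i + k * d) {i : ℕ} {a : ℤ}
    (hprev : ∀ j, i = j + 1 → ∀ e, (F.deg j e).1 ≠ a) (hlt : i < a) (e : Fin (F.rank i)) :
    (F.deg i e).1 ≠ a := by
  intro ha
  obtain ⟨k, hk⟩ := Int.eq_ofNat_of_zero_le (deg_rees_snd_nonneg hd F i e)
  have hdeg : F.deg i e = (a, (k : ℤ)) := Prod.ext ha hk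
  obtain ⟨φ, hφ, hφε⟩ := exists_lift_powToRees hf F (L k)
  obtain ⟨ψ, hψ, hψε⟩ := exists_lift_reesToPow hf F (L k)
  have hmem : Pi.single e 1 ∈ freeGrading K (biWeight n m) (F.deg i) (a, (k : ℤ)) := by
    rw [← hdeg]
    exact single_mem_freeGrading _ _ _
  obtain ⟨w, hw⟩ := exists_sub_mem_varMul (F.toBigradedStrand k) ((L k).toStrand (k * d))
    ψ hψ (fun a z hz hc => by
      have hc' : F.ε z = 0 := hc
      change (L k).ε (ψ z) = 0
      rw [hψε a z hz, hc', map_zero])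
    φ hφ (fun a z hz hc => by
      have hc' : (L k).ε z = 0 := hc
      change F.ε (φ z) = 0
      rw [hφε a z hz, hc', map_zero])
    (fun a z hz => by
      refine (F.ε.map_sub _ _).trans (sub_eq_zero.2 ?_)
      rw [hφε a _ (hψ a z hz), hψε a z hz, powToRees_reesToPow
        ((isGradedModule_reesGrading hf).map_mem F.ε_homogeneous hz)])
    i a
    (fun y hy => mem_varMul_of_mem_freeGrading
      (fun e' he' => by have := hL k i e'; omega) hy)
    (Pi.single e 1) hmem
    (by
      rintro j rfl
      exact mem_varMul_of_mem_freeGrading_strand (hprev j rfl) (F.d_mem j hmem))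
  -- Elements of (x)F have no constant terms, and neither do boundaries, by minimality over A; the
  -- basis vector has constant term 1 at `e`.
  have h1 := constantCoeff_of_mem_varMul_inl hw e
  have h2 : constantCoeff (F.d i w e) = 0 := F.constantCoeff_d i w e
  change constantCoeff
    ((Pi.single e 1 : Fin (F.rank i) → MvPolynomial (Fin n ⊕ Fin m) K) e - F.d i w e) = 0 at h1
  rw [map_sub, h2, Pi.single_eq_same, map_one, sub_zero] at h1
  exact one_ne_zero h1

/-- Bounds for the degrees in resolutions of the powers yield bounds for the first degrees in the
resolutions of the Rees algebra. -/
theorem deg_rees_le (hd : IsGeneratedInDegree I d)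
    (hf : ∀ j, (f j : MvPolynomial (Fin n) K).IsHomogeneous d)
    (F : MinimalGradedFreeResolution K (biWeight n m) (reesGrading I f d))
    (L : ∀ k : ℕ, MinimalGradedFreeResolution K (stdWeight n) (idealGrading (I ^ k)))
    (hL : ∀ (k i : ℕ) (e),  (L k).deg i e ≤ i + k * d) (i : ℕ) (e : Fin (F.rank i)) :
    (F.deg i e).1 ≤ i := by
  by_contra hlt
  rw [not_le] at hlt
  obtain ⟨a, ha⟩ : ∃ a, (F.deg i e).1 = a := ⟨_, rfl⟩
  rw [ha] at hlt
  -- The first degree `a` stays fixed while the position varies: a > i + 1 implies a > i, so the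
  -- induction hypothesis excludes `a` one position lower, as `hprev` requires.
  induction i with
  | zero => exact deg_rees_ne hd hf F L hL (by simp) hlt e ha
  | succ i ih =>
    refine deg_rees_ne hd hf F L hL ?_ hlt e ha
    rintro j hj e' he'
    obtain rfl : i = j := by omega
    exact ih e' (by push_cast at hlt; omega) he'

end ReesComparison

/-! ### Regularity as a bound on the degrees of a resolution -/

section Regularity

variable {K : Type u} [Field K] {n m : ℕ}

theorem bettiNumber_ne_zero_iff {σ : Type v} {G : Type} [AddCommGroup G] {M : Type w}
    [AddCommGroup M] [Module (MvPolynomial σ K) M] {wt : σ → G} {ℳ : G → AddSubgroup M}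
    (h : Nonempty (MinimalGradedFreeResolution K wt ℳ)) (i : ℕ) (g : G) :
    bettiNumber K wt ℳ i g ≠ 0 ↔ ∃ e, h.some.deg i e = g := by
  rw [bettiNumber, dif_pos h, Nat.card_ne_zero]
  exact ⟨fun ⟨⟨e⟩, _⟩ => ⟨e.1, e.2⟩, fun ⟨e, he⟩ => ⟨⟨⟨e, he⟩⟩, inferInstance⟩⟩

/-- With the lower bound `hc` given, equality reduces to `c` being an upper bound, and the supremum
is then attained. -/
theorem sSup_intCast_eq_iff (T : Set ℤ) {c : ℤ} (hc : ∃ t ∈ T, c ≤ t) :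
    sSup {r : EReal | ∃ t ∈ T, r = ((t : ℝ) : EReal)} = ((c : ℝ) : EReal) ↔ ∀ t ∈ T, t ≤ c := by
  constructor
  · intro h t ht
    have : ((t : ℝ) : EReal) ≤ ((c : ℝ) : EReal) := h ▸ le_sSup ⟨t, ht, rfl⟩
    exact_mod_cast this
  · intro h
    obtain ⟨t, ht, hct⟩ := hc
    obtain rfl : t = c := le_antisymm (h t ht) hct
    refine le_antisymm (sSup_le ?_) (le_sSup ⟨t, ht, rfl⟩)
    rintro _ ⟨t', ht', rfl⟩
    exact_mod_cast h t' ht'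

theorem castelnuovoMumfordReg_eq_iff {M : Type w} [AddCommGroup M]
    [Module (MvPolynomial (Fin n) K) M] {ℳ : ℤ → AddSubgroup M}
    (h : Nonempty (MinimalGradedFreeResolution K (stdWeight n) ℳ)) {c : ℤ}
    (hc : ∃ e, c ≤ h.some.deg 0 e) :
    castelnuovoMumfordReg K n ℳ = ((c : ℝ) : EReal) ↔ ∀ i e, h.some.deg i e ≤ i + c := by
  have hset : {r : EReal | ∃ (i : ℕ) (j : ℤ),
      bettiNumber K (stdWeight n) ℳ i j ≠ 0 ∧ r = (((j - i : ℤ) : ℝ) : EReal)} =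
      {r : EReal | ∃ t ∈ {t : ℤ | ∃ i e, h.some.deg i e - i = t}, r = ((t : ℝ) : EReal)} := by
    ext r
    constructor
    · rintro ⟨i, j, hb, rfl⟩
      obtain ⟨e, rfl⟩ := (bettiNumber_ne_zero_iff h i j).1 hb
      exact ⟨_, ⟨i, e, rfl⟩, rfl⟩
    · rintro ⟨_, ⟨i, e, rfl⟩, rfl⟩
      exact ⟨i, _, (bettiNumber_ne_zero_iff h i _).2 ⟨e, rfl⟩, rfl⟩
  have hc' : ∃ t ∈ {t : ℤ | ∃ i e, h.some.deg i e - i = t}, c ≤ t :=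
    hc.elim fun e he => ⟨_, ⟨0, e, rfl⟩, by simpa using he⟩
  rw [castelnuovoMumfordReg, hset, sSup_intCast_eq_iff _ hc']
  constructor
  · intro H i e
    have := H _ ⟨i, e, rfl⟩
    linarith
  · rintro H _ ⟨i, e, rfl⟩
    linarith [H i e]

theorem reg10_eq_zero_iff {M : Type w} [AddCommGroup M]
    [Module (MvPolynomial (Fin n ⊕ Fin m) K) M] {ℳ : ℤ × ℤ → AddSubgroup M}
    (h : Nonempty (MinimalGradedFreeResolution K (biWeight n m) ℳ))
    (hc : ∃ e, 0 ≤ (h.some.deg 0 e).1) :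
    reg10 K n m ℳ = 0 ↔ ∀ i e, (h.some.deg i e).1 ≤ i := by
  have hset : {r : EReal | ∃ (i : ℕ) (a : ℤ),
      (∃ b : ℤ, bettiNumber K (biWeight n m) ℳ i (a, b) ≠ 0) ∧
        r = (((a - i : ℤ) : ℝ) : EReal)} =
      {r : EReal | ∃ t ∈ {t : ℤ | ∃ i e, (h.some.deg i e).1 - i = t}, r = ((t : ℝ) : EReal)} := by
    ext r
    constructor
    · rintro ⟨i, a, ⟨b, hb⟩, rfl⟩
      obtain ⟨e, he⟩ := (bettiNumber_ne_zero_iff h i _).1 hb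
      exact ⟨_, ⟨i, e, rfl⟩, by rw [he]⟩
    · rintro ⟨_, ⟨i, e, rfl⟩, rfl⟩
      exact ⟨i, _, ⟨_, (bettiNumber_ne_zero_iff h i _).2 ⟨e, rfl⟩⟩, rfl⟩
  have hc' : ∃ t ∈ {t : ℤ | ∃ i e, (h.some.deg i e).1 - i = t}, 0 ≤ t :=
    hc.elim fun e he => ⟨_, ⟨0, e, rfl⟩, by simpa using he⟩
  rw [reg10, hset, show (0 : EReal) = (((0 : ℤ) : ℝ) : EReal) by simp,
    sSup_intCast_eq_iff _ hc']
  constructor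
  · intro H i e
    have := H _ ⟨i, e, rfl⟩
    linarith
  · rintro H _ ⟨i, e, rfl⟩
    linarith [H i e]

/-- The lower bound comes from a generator in position 0: it maps to a nonzero form of I^k, which
has degree at least kd. -/
theorem castelnuovoMumfordReg_pow_eq_iff {I : Ideal (MvPolynomial (Fin n) K)} (hI : I ≠ ⊥) {d : ℕ}
    (hd : IsGeneratedInDegree I d) (k : ℕ) :
    castelnuovoMumfordReg K n (idealGrading (I ^ k)) = (((k * d : ℕ) : ℝ) : EReal) ↔
      ∀ i e, (nonempty_resolution_pow hd k).some.deg i e ≤ i + k * d := by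
  have hne : I ^ k ≠ ⊥ := pow_ne_zero k hI
  have : Nontrivial ↥(I ^ k) := Submodule.nontrivial_iff_ne_bot.2 hne
  let L := (nonempty_resolution_pow hd k).some
  have := castelnuovoMumfordReg_eq_iff (nonempty_resolution_pow hd k) (c := k * d) ?_
  · rw [← this]
    push_cast
    rfl
  let e : Fin (L.rank 0) := ⟨0, Nat.pos_of_ne_zero L.rank_zero_ne_zero⟩
  refine ⟨e, le_of_isWeightedHomogeneous_of_mem_pow hd (L.ε (Pi.single e 1)).2 ?_
    (L.ε_homogeneous e)⟩
  exact fun h => L.single_notMem_cycles 0 e (Subtype.ext h)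

theorem reg10_rees_eq_zero_iff {I : Ideal (MvPolynomial (Fin n) K)} {d : ℕ}
    (hd : IsGeneratedInDegree I d) {f : Fin m → I}
    (h : Nonempty (MinimalGradedFreeResolution K (biWeight n m) (reesGrading I f d))) :
    reg10 K n m (reesGrading I f d) = 0 ↔ ∀ i e, (h.some.deg i e).1 ≤ i := by
  have : Nontrivial (ReesModule I f) := inferInstanceAs (Nontrivial (reesAlgebra I))
  refine reg10_eq_zero_iff h ?_
  let e : Fin (h.some.rank 0) := ⟨0, Nat.pos_of_ne_zero h.some.rank_zero_ne_zero⟩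
  exact ⟨e, (nonneg_of_ne_zero_of_mem_reesGrading hd (h.some.ε_homogeneous e)
    (h.some.single_notMem_cycles 0 e)).1⟩

theorem hasLinearPowers_iff {I : Ideal (MvPolynomial (Fin n) K)} (hI : I ≠ ⊥) {d : ℕ}
    (hd : IsGeneratedInDegree I d) :
    HasLinearPowers I ↔
      ∀ (k i : ℕ) (e), (nonempty_resolution_pow hd k).some.deg i e ≤ i + k * d := by
  rw [← forall_congr' (castelnuovoMumfordReg_pow_eq_iff hI hd)]
  constructor
  · rintro ⟨d', hd', h⟩
    obtain rfl : d' = d := le_antisymm (hd'.le hI hd) (hd.le hI hd')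
    exact h
  · exact fun h => ⟨d, hd, h⟩

end Regularity

end

theorem theorem2p4 {K : Type*} [Field K] [Infinite K] {n : ℕ}
    (I : Ideal (MvPolynomial (Fin n) K)) (hI : I ≠ ⊥)
    (d : ℕ) (hd : IsGeneratedInDegree I d)
    (m : ℕ) (hm : m = Submodule.spanFinrank I)
    (f : Fin m → I) (hf : ∀ j, (f j : MvPolynomial (Fin n) K).IsHomogeneous d)
    (hfI : Ideal.span (Set.range fun j => (f j : MvPolynomial (Fin n) K)) = I) :
    HasLinearPowers I ↔ reg10 K n m (reesGrading I f d) = 0 := by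
  have h := nonempty_resolution_rees hf hfI
  rw [hasLinearPowers_iff hI hd, reg10_rees_eq_zero_iff hd h]
  exact ⟨fun H => deg_rees_le hd hf h.some _ H, fun H k => deg_pow_le hf h.some H _⟩
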